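/- **Theorem.** Let $M$ be a fixed finite monoid. For $x\in M$ let $\omega=\omega(x)$ be the least positive integer such that $x^{\omega}$ is idempotent, and suppose that $M$ belongs to the class $\mathbf{ZG}$, i.e., $x^{\omega+1}y=y\,x^{\omega+1}$ for all $x,y\in M$. Then the dynamic word problem for $M$ is in $O(1)$. Here, in the *dynamic word problem* for $M$, a word $w=w_1\cdots w_n\in M^*$ is given, and one has to maintain it under letter substitution updates $(i,a)$ with $1\le i\le n$ and $a\in M$, which replace the $i$-th letter of the word by $a$, and to answer queries that ask for the evaluation of the current word, i.e., the product in $M$ of its letters. The computation model is the unit-cost RAM: each cell stores an integer of value at most polynomial in $n$, and each instruction (arithmetic operation, memory access, jump) takes unit time. The problem is *in $O(1)$* if there is an algorithm, depending only on $M$ (and on the encoding of its elements by the integers $0,\dots,|M|-1$), which preprocesses $w$ in time $O(n)$ to build a data structure, and then handles every update and every query of any sequence of such operations correctly in worst-case time $O(1)$, i.e., bounded by a constant that does not depend on $n$, on $w$ or on the operations. -/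

import Mathlib

/-! ## The unit-cost RAM -/

namespace RAM

/-- The unit-cost arithmetic operations on cell contents (natural numbers). -/
inductive ArithOp where
  | add | sub | mul | div | mod

/-- `sub` is truncated subtraction, `x div 0 = 0` and `x mod 0 = x`. -/
def ArithOp.apply : ArithOp → ℕ → ℕ → ℕ
  | .add, x, y => x + y
  | .sub, x, y => x - y
  | .mul, x, y => x * y
  | .div, x, y => x / y
  | .mod, x, y => x % y

/-- The contents of the cells. Cells are split into registers, which an instruction names directly
(so that a program only uses finitely many of them), and the main memory, which is addressed
indirectly through registers. -/
@[ext] structure State where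
  reg : ℕ → ℕ
  mem : ℕ → ℕ

/-- Overwrite register `r` by `v`. -/
def State.setReg (s : State) (r v : ℕ) : State := { s with reg := Function.update s.reg r v }

/-- Overwrite the memory cell of address `p` by `v`. -/
def State.setMem (s : State) (p v : ℕ) : State := { s with mem := Function.update s.mem p v }

/-- The instructions; each execution of an instruction costs one unit of time.
* `const r k`: `r := k`
* `move r a`: `r := a`
* `arith o r a b`: `r := a o b`
* `load r a`: `r := mem[a]`
* `store a r`: `mem[a] := r`
* `jump l`: go to instruction number `l`
* `jumpZero r l`: go to instruction number `l` if register `r` contains `0`. -/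
inductive Instr where
  | const (r k : ℕ)
  | move (r a : ℕ)
  | arith (o : ArithOp) (r a b : ℕ)
  | load (r a : ℕ)
  | store (a r : ℕ)
  | jump (l : ℕ)
  | jumpZero (r l : ℕ)

/-- A program is a finite list of instructions, numbered from `0`. -/
abbrev Program := List Instr

/-- A configuration: the number of the next instruction, and the contents of the cells. -/
@[ext] structure Config where
  pc : ℕ
  state : State

/-- The effect of one instruction. -/
def Instr.exec : Instr → Config → Config
  | .const r k, ⟨pc, s⟩ => ⟨pc + 1, s.setReg r k⟩
  | .move r a, ⟨pc, s⟩ => ⟨pc + 1, s.setReg r (s.reg a)⟩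
  | .arith o r a b, ⟨pc, s⟩ => ⟨pc + 1, s.setReg r (o.apply (s.reg a) (s.reg b))⟩
  | .load r a, ⟨pc, s⟩ => ⟨pc + 1, s.setReg r (s.mem (s.reg a))⟩
  | .store a r, ⟨pc, s⟩ => ⟨pc + 1, s.setMem (s.reg a) (s.reg r)⟩
  | .jump l, ⟨_, s⟩ => ⟨l, s⟩
  | .jumpZero r l, ⟨pc, s⟩ => ⟨if s.reg r = 0 then l else pc + 1, s⟩

/-- One step of a program; nothing happens once the program has halted, that is, once the program
counter is past the end of the program. -/
def step (P : Program) (c : Config) : Config :=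
  match P[c.pc]? with
  | none => c
  | some i => i.exec c

/-- All cells contain integers of value at most `B`. -/
def State.Bounded (s : State) (B : ℕ) : Prop :=
  (∀ r, s.reg r ≤ B) ∧ ∀ p, s.mem p ≤ B

/-- Started at its first instruction on the state `s`, the program `P` halts after executing exactly
`t` instructions, in the state `s'`, and no cell ever contains a value larger than `B`. -/
def Run (P : Program) (B : ℕ) (s : State) (t : ℕ) (s' : State) : Prop :=
  (∀ k < t, ((step P)^[k] ⟨0, s⟩).pc < P.length) ∧
  P.length ≤ ((step P)^[t] ⟨0, s⟩).pc ∧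
  ((step P)^[t] ⟨0, s⟩).state = s' ∧
  ∀ k ≤ t, ((step P)^[k] ⟨0, s⟩).state.Bounded B

end RAM

/-! ## The dynamic word problem -/

namespace DynamicWord

open RAM

/-- An algorithm for a dynamic problem: the three programs that implement the preprocessing, the
updates and the queries. They share the cells, whose contents persist between operations. -/
structure Algorithm where
  preprocess : Program
  update : Program
  query : Program

section

variable {M : Type*} [Monoid M]

/-- The input of the preprocessing for the word `w` of length `n`: register `0` contains `n`, the
memory cell `i < n` contains (the code of) the `i`-th letter of `w`, all other cells contain `0`. -/
def inputState (e : M ≃ Fin (Nat.card M)) {n : ℕ} (w : Fin n → M) : State where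
  reg := fun r => if r = 0 then n else 0
  mem := fun p => if h : p < n then (e (w ⟨p, h⟩) : ℕ) else 0

/-- The input of the update `(i, a)`: the position is passed in register `0`, the new letter in
register `1`. -/
def updateState (e : M ≃ Fin (Nat.card M)) {n : ℕ} (s : State) (i : Fin n) (a : M) : State :=
  (s.setReg 0 i).setReg 1 (e a)

/-- `Reachable A e B w s u`: from the initial word `w`, after the preprocessing and some finite
sequence of updates and queries, the cells can be in the state `s` while the current word is `u`. -/
inductive Reachable (A : Algorithm) (e : M ≃ Fin (Nat.card M)) (B : ℕ) {n : ℕ} (w : Fin n → M) :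
    State → (Fin n → M) → Prop
  | preprocess {t : ℕ} {s : State} (h : Run A.preprocess B (inputState e w) t s) :
      Reachable A e B w s w
  | update {s s' : State} {u : Fin n → M} {t : ℕ} (i : Fin n) (a : M)
      (hs : Reachable A e B w s u) (h : Run A.update B (updateState e s i a) t s') :
      Reachable A e B w s' (Function.update u i a)
  | query {s s' : State} {u : Fin n → M} {t : ℕ}
      (hs : Reachable A e B w s u) (h : Run A.query B s t s') :
      Reachable A e B w s' u

/-- The algorithm `A` correctly maintains the evaluation in `M` of words under letter substitutions.
On words of length `n`, the preprocessing takes time at most `Tpre n`, every update and every query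
takes time at most `T n` in the worst case, and all cells always contain integers of value at most
`V n`. Queries return (the code of) the product of the letters of the current word in
register `0`. -/
structure Solves (A : Algorithm) (e : M ≃ Fin (Nat.card M)) (V Tpre T : ℕ → ℕ) : Prop where
  preprocess : ∀ (n : ℕ) (w : Fin n → M),
    ∃ t ≤ Tpre n, ∃ s, Run A.preprocess (V n) (inputState e w) t s
  update : ∀ (n : ℕ) (w : Fin n → M) (s : State) (u : Fin n → M),
    Reachable A e (V n) w s u → ∀ (i : Fin n) (a : M),
      ∃ t ≤ T n, ∃ s', Run A.update (V n) (updateState e s i a) t s'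
  query : ∀ (n : ℕ) (w : Fin n → M) (s : State) (u : Fin n → M),
    Reachable A e (V n) w s u →
      ∃ t ≤ T n, ∃ s', Run A.query (V n) s t s' ∧ s'.reg 0 = (e (List.ofFn u).prod : ℕ)

end

/-- The dynamic word problem for the (fixed) finite monoid `M` is in `O(f)`: however the elements of
`M` are encoded by `0, …, |M| - 1`, there is an algorithm on the unit-cost RAM, whose cells store
integers of value at most polynomial in the length `n` of the word, with preprocessing in time `O(n)`
and with worst-case time `O(f(n))` for each update and for each query. -/
def InO (M : Type*) [Monoid M] (f : ℕ → ℝ) : Prop :=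
  ∀ e : M ≃ Fin (Nat.card M), ∃ (A : Algorithm) (V : Polynomial ℕ) (Tpre T : ℕ → ℕ),
    (fun n => (Tpre n : ℝ)) =O[Filter.atTop] (fun n => (n : ℝ)) ∧
    (fun n => (T n : ℝ)) =O[Filter.atTop] f ∧
    Solves A e (fun n => V.eval n) Tpre T

end DynamicWord

/-! ## The class ZG -/

/-- The idempotent power `ω` of `x`: the least positive integer such that `x ^ ω` is idempotent. It
exists for every element of a finite monoid, see `idempotentPower_spec`. -/
noncomputable def idempotentPower {M : Type*} [Monoid M] (x : M) : ℕ :=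
  sInf {k : ℕ | 0 < k ∧ IsIdempotentElem (x ^ k)}

theorem idempotentPower_spec {M : Type*} [Monoid M] [Finite M] (x : M) :
    0 < idempotentPower x ∧ IsIdempotentElem (x ^ idempotentPower x) := by
  refine Nat.sInf_mem (s := {k : ℕ | 0 < k ∧ IsIdempotentElem (x ^ k)}) ?_
  obtain ⟨i, j, hij, h⟩ := Finite.exists_ne_map_eq_of_infinite (fun k : ℕ => x ^ k)
  wlog hlt : i < j generalizing i j
  · exact this j i hij.symm h.symm (by omega)
  obtain ⟨d, hd, rfl⟩ : ∃ d, 0 < d ∧ j = i + d := ⟨j - i, by omega, by omega⟩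
  have key : ∀ q r : ℕ, x ^ (i + r + q * d) = x ^ (i + r) := by
    intro q r
    induction q with
    | zero => simp
    | succ q ih =>
      have h' : x ^ i = x ^ (i + d) := h
      calc x ^ (i + r + (q + 1) * d) = x ^ (i + d) * x ^ (r + q * d) := by
            rw [← pow_add]; ring_nf
        _ = x ^ (i + r + q * d) := by rw [← h', ← pow_add]; ring_nf
        _ = _ := ih
  refine ⟨(i + 1) * d, by positivity, ?_⟩
  have hle : i ≤ (i + 1) * d := by nlinarith
  obtain ⟨r, hr⟩ := Nat.exists_eq_add_of_le hle
  have hk := key (i + 1) r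
  rw [← hr] at hk
  rw [IsIdempotentElem, ← pow_add]
  exact hk

/-- The class `ZG`: `x ^ (ω + 1) * y = y * x ^ (ω + 1)` for all `x`, `y`. -/
def IsZG (M : Type*) [Monoid M] : Prop :=
  ∀ x y : M, x ^ (idempotentPower x + 1) * y = y * x ^ (idempotentPower x + 1)

/-! Read a word from left to right and let `p` be the product of the letters read so far. The right
ideal `pM` can only shrink, and it cannot shrink strictly at each of `|M|` occurrences of a letter
`a`. Where it does not shrink on reading `a`, one has `p = p * a * y` for some `y`; since
idempotents are central in `ZG`, this forces `p * a ^ ω = p` (`mul_pow_idempotentPower_of_eq`). So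
the value of a word with at least `|M|` occurrences of `a` absorbs the factor `a ^ ω`
(`prod_mul_pow_idempotentPower`). As all powers `a ^ (ω + c)` are central, the occurrences of `a`
can then be gathered in front, as a power that depends only on their number modulo `ω`. After doing
this for all frequent letters (`prod_eq_prod_frequent_mul`), at most `|M| ^ 2` positions with rare
letters remain, to be multiplied in order.

It is therefore enough to keep, for each letter, an unordered list of its positions together with
its length, and for each position its index in its list. A substitution deletes from one list, by
moving the last entry into the gap, and appends to another (`Bags.remove`, `Bags.insert`). A query
finds the rare positions in increasing order by a bounded number of minimum searches over boundedly
many list entries (`eval_scan`, `eval_queryExp`).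

Updates and queries are straight-line programs of fixed length, and so is the loop body of the
preprocessing. An instruction at most squares the bound on the cells, so a fixed number of them
stays polynomial. The invariant `Represents` restores the linear bound `n + c` after every
operation, so that values do not grow along a sequence of operations. -/

namespace RAM

/-! ### Straight-line code -/

/-- The instruction is not a jump. -/
def Instr.IsStraight : Instr → Prop
  | .jump _ => False
  | .jumpZero _ _ => False
  | _ => True

/-- The constant written by the instruction, if any, is at most `c`. -/
def Instr.ConstLE (c : ℕ) : Instr → Prop
  | .const _ k => k ≤ c
  | _ => True

/-- The effect of an instruction on the cells. -/
def Instr.act (i : Instr) (s : State) : State := (i.exec ⟨0, s⟩).state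

/-- The effect on the cells of executing the instructions of a list one after the other. -/
def runs (P : Program) (s : State) : State := P.foldl (fun s i => i.act s) s

@[simp] theorem runs_nil (s : State) : runs [] s = s := rfl

@[simp] theorem runs_cons (i : Instr) (P : Program) (s : State) :
    runs (i :: P) s = runs P (i.act s) := rfl

@[simp] theorem runs_append (P Q : Program) (s : State) :
    runs (P ++ Q) s = runs Q (runs P s) := by
  simp [runs]

theorem Instr.IsStraight.exec {i : Instr} (hi : i.IsStraight) (pc : ℕ) (s : State) :
    i.exec ⟨pc, s⟩ = ⟨pc + 1, i.act s⟩ := by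
  cases i <;> first | rfl | exact hi.elim

theorem Instr.ConstLE.mono {i : Instr} {c d : ℕ} (h : i.ConstLE c) (hcd : c ≤ d) :
    i.ConstLE d := by
  cases i <;> first | trivial | exact le_trans h hcd

theorem State.Bounded.mono {s : State} {B C : ℕ} (h : s.Bounded B) (hBC : B ≤ C) :
    s.Bounded C :=
  ⟨fun r => (h.1 r).trans hBC, fun p => (h.2 p).trans hBC⟩

theorem State.Bounded.setReg {s : State} {B r v : ℕ} (h : s.Bounded B) (hv : v ≤ B) :
    (s.setReg r v).Bounded B := by
  refine ⟨fun r' => ?_, h.2⟩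
  by_cases hr : r' = r
  · subst hr; simpa [State.setReg] using hv
  · simpa [State.setReg, hr] using h.1 r'

theorem State.Bounded.setMem {s : State} {B p v : ℕ} (h : s.Bounded B) (hv : v ≤ B) :
    (s.setMem p v).Bounded B := by
  refine ⟨h.1, fun p' => ?_⟩
  by_cases hp : p' = p
  · subst hp; simpa [State.setMem] using hv
  · simpa [State.setMem, hp] using h.2 p'

/-- Multiplication is the worst case; `2 ≤ B` is what lets the square also dominate a sum. -/
theorem ArithOp.apply_le (o : ArithOp) {x y B : ℕ} (hB : 2 ≤ B) (hx : x ≤ B) (hy : y ≤ B) :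
    o.apply x y ≤ B ^ 2 := by
  have h : B ≤ B ^ 2 := by nlinarith
  cases o
  · show x + y ≤ _; nlinarith
  · exact (Nat.sub_le _ _).trans (hx.trans h)
  · rw [sq]; exact Nat.mul_le_mul hx hy
  · exact (Nat.div_le_self _ _).trans (hx.trans h)
  · exact (Nat.mod_le _ _).trans (hx.trans h)

theorem State.Bounded.act {s : State} {B : ℕ} {i : Instr} (hB : 2 ≤ B) (h : s.Bounded B)
    (hi : i.ConstLE B) : (i.act s).Bounded (B ^ 2) := by
  have hBB : B ≤ B ^ 2 := by nlinarith
  have h' := h.mono hBB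
  cases i with
  | const r k => exact h'.setReg (le_trans hi hBB)
  | move r a => exact h'.setReg (h'.1 a)
  | arith o r a b => exact h'.setReg (o.apply_le hB (h.1 a) (h.1 b))
  | load r a => exact h'.setReg (h'.2 _)
  | store a r => exact h'.setMem (h'.1 r)
  | jump l => exact h'
  | jumpZero r l => exact h'

/-- Each instruction at most squares the bound. The exponent depends only on the program, so a bound
linear in the length of the word becomes a polynomial one. -/
theorem State.Bounded.runs {P : Program} : ∀ {s : State} {B : ℕ}, 2 ≤ B → s.Bounded B →
    (∀ i ∈ P, i.ConstLE B) → (runs P s).Bounded (B ^ 2 ^ P.length) := by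
  induction P with
  | nil => intro s B _ h _; simpa using h
  | cons i P ih =>
    intro s B hB h hP
    have hBB : B ≤ B ^ 2 := by nlinarith
    have := ih (hB.trans hBB) (h.act hB (hP i (by simp)))
      (fun j hj => (hP j (by simp [hj])).mono hBB)
    rw [← pow_mul, ← pow_succ'] at this
    exact this

theorem exists_constLE (P : Program) : ∃ c, ∀ i ∈ P, i.ConstLE c := by
  induction P with
  | nil => exact ⟨0, by simp⟩
  | cons i P ih =>
    obtain ⟨c, hc⟩ := ih
    have hi : ∃ d, i.ConstLE d := by
      cases i
      case const r k => exact ⟨k, le_refl k⟩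
      all_goals exact ⟨0, trivial⟩
    obtain ⟨d, hd⟩ := hi
    refine ⟨max c d, fun j hj => ?_⟩
    rcases List.mem_cons.1 hj with rfl | hj
    · exact hd.mono (le_max_right _ _)
    · exact (hc j hj).mono (le_max_left _ _)

/-! ### Partial executions -/

/-- The program `P` gets from `c` to `c'` in `t` steps, without halting before, and without
exceeding the value bound `B`. -/
structure Path (P : Program) (B : ℕ) (c : Config) (t : ℕ) (c' : Config) : Prop where
  iterate : (step P)^[t] c = c'
  running : ∀ k < t, ((step P)^[k] c).pc < P.length
  bounded : ∀ k ≤ t, ((step P)^[k] c).state.Bounded B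

theorem Path.trans {P : Program} {B t t' : ℕ} {c c' c'' : Config} (h : Path P B c t c')
    (h' : Path P B c' t' c'') : Path P B c (t + t') c'' := by
  have key : ∀ k, (step P)^[t + k] c = (step P)^[k] c' := fun k => by
    rw [add_comm, Function.iterate_add_apply, h.iterate]
  refine ⟨by rw [key, h'.iterate], fun k hk => ?_, fun k hk => ?_⟩
  · rcases lt_or_ge k t with hkt | hkt
    · exact h.running k hkt
    · obtain ⟨j, rfl⟩ := Nat.exists_eq_add_of_le hkt
      rw [key]; exact h'.running j (by omega)
  · rcases le_or_gt k t with hkt | hkt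
    · exact h.bounded k hkt
    · obtain ⟨j, rfl⟩ := Nat.exists_eq_add_of_le hkt.le
      rw [key]; exact h'.bounded j (by omega)

theorem Path.single {P : Program} {B : ℕ} {c c' : Config} {i : Instr} (hi : P[c.pc]? = some i)
    (hc : i.exec c = c') (h : c.state.Bounded B) (h' : c'.state.Bounded B) : Path P B c 1 c' := by
  have hs : step P c = c' := by simp [step, hi, hc]
  refine ⟨by simpa using hs, fun k hk => ?_, fun k hk => ?_⟩
  · obtain rfl : k = 0 := by omega
    exact (List.getElem?_eq_some_iff.1 hi).1
  · obtain rfl | rfl : k = 0 ∨ k = 1 := by omega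
    · exact h
    · simpa [hs] using h'

theorem Path.run {P : Program} {B t : ℕ} {s s' : State} {pc : ℕ}
    (h : Path P B ⟨0, s⟩ t ⟨pc, s'⟩) (hpc : P.length ≤ pc) : Run P B s t s' :=
  ⟨h.running, by rw [h.iterate]; exact hpc, by rw [h.iterate], h.bounded⟩

/-- The machine is deterministic and a run stops at the first time it leaves the program. This
identifies an arbitrary run occurring in `Reachable` with the one constructed explicitly. -/
theorem Run.state_eq {P : Program} {B t t' : ℕ} {s s₁ s₂ : State} (h : Run P B s t s₁)
    (h' : Run P B s t' s₂) : s₁ = s₂ := by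
  obtain ⟨h1, h2, h3, -⟩ := h
  obtain ⟨h1', h2', h3', -⟩ := h'
  have htt : t = t' := by
    rcases lt_trichotomy t t' with hlt | heq | hlt
    · exact absurd h2 (not_le.2 (h1' t hlt))
    · exact heq
    · exact absurd h2' (not_le.2 (h1 t' hlt))
  subst htt
  exact h3.symm.trans h3'

theorem iterate_step_straight (A P C : Program) (hP : ∀ i ∈ P, i.IsStraight) (s : State) :
    ∀ k ≤ P.length, (step (A ++ P ++ C))^[k] ⟨A.length, s⟩
      = ⟨A.length + k, runs (P.take k) s⟩ := by
  intro k
  induction k with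
  | zero => simp
  | succ k ih =>
    intro hk
    rw [Function.iterate_succ_apply', ih (by omega)]
    have hget : (A ++ P ++ C)[A.length + k]? = some P[k] := by
      rw [List.append_assoc, List.getElem?_append_right (by omega), Nat.add_sub_cancel_left,
        List.getElem?_append_left (by omega), List.getElem?_eq_getElem (by omega)]
    rw [List.take_succ_eq_append_getElem (by omega), runs_append]
    simp only [step, hget, runs_cons, runs_nil]
    rw [(hP _ (List.getElem_mem _)).exec]
    rfl

theorem Path.straight (A P C : Program) (hP : ∀ i ∈ P, i.IsStraight) {s : State} {B V : ℕ}
    (hB : 2 ≤ B) (hPB : ∀ i ∈ P, i.ConstLE B) (hs : s.Bounded B) (hV : B ^ 2 ^ P.length ≤ V) :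
    Path (A ++ P ++ C) V ⟨A.length, s⟩ P.length ⟨A.length + P.length, runs P s⟩ := by
  refine ⟨?_, fun k hk => ?_, fun k hk => ?_⟩
  · rw [iterate_step_straight A P C hP s _ le_rfl, List.take_length]
  · rw [iterate_step_straight A P C hP s k hk.le]
    simp; omega
  · rw [iterate_step_straight A P C hP s k hk]
    refine (State.Bounded.runs hB hs fun i hi => hPB i (List.mem_of_mem_take hi)).mono
      (le_trans ?_ hV)
    refine Nat.pow_le_pow_right (by omega) (Nat.pow_le_pow_right (by omega) ?_)
    simp

theorem run_straight {P : Program} (hP : ∀ i ∈ P, i.IsStraight) {s : State} {B V : ℕ}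
    (hB : 2 ≤ B) (hPB : ∀ i ∈ P, i.ConstLE B) (hs : s.Bounded B) (hV : B ^ 2 ^ P.length ≤ V) :
    Run P V s P.length (runs P s) := by
  have h := Path.straight [] P [] hP hB hPB hs hV
  simp only [List.nil_append, List.append_nil, List.length_nil, zero_add] at h
  exact h.run le_rfl

/-! ### Counting loops -/

/-- Execute `A`, and then `P` again and again until register `r` contains `0`. -/
def loop (A : Program) (r : ℕ) (P : Program) : Program :=
  A ++ [.jumpZero r (A.length + P.length + 2)] ++ P ++ [.jump A.length]

/-- `I k` is the invariant at the loop head with `k` rounds left. It includes the bound `B`, so each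
round starts again from `B` and the squarings do not accumulate over the rounds. -/
theorem path_loop {A P : Program} {r : ℕ} (hP : ∀ i ∈ P, i.IsStraight) {B V : ℕ}
    (hB : 2 ≤ B) (hPB : ∀ i ∈ P, i.ConstLE B) (hV : B ^ 2 ^ P.length ≤ V)
    (I : ℕ → State → Prop) (hbd : ∀ k s, I k s → s.Bounded B) (hr : ∀ k s, I k s → s.reg r = k)
    (hI : ∀ k s, I (k + 1) s → I k (runs P s)) :
    ∀ (k : ℕ) (s : State), I k s → ∃ s', I 0 s' ∧
      Path (loop A r P) V ⟨A.length, s⟩ (k * (P.length + 2) + 1) ⟨(loop A r P).length, s'⟩ := by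
  have hBV : B ≤ V := le_trans (Nat.le_self_pow (by positivity) B) hV
  have hlen : (loop A r P).length = A.length + P.length + 2 := by simp [loop]; omega
  have hget : (loop A r P)[A.length]? = some (.jumpZero r (A.length + P.length + 2)) := by
    simp [loop]
  have hget' : (loop A r P)[A.length + 1 + P.length]? = some (.jump A.length) := by
    have h0 : A.length + 1 + P.length
        = (A ++ [Instr.jumpZero r (A.length + P.length + 2)] ++ P).length := by simp; omega
    rw [loop, h0, List.getElem?_concat_length]
  intro k
  induction k with
  | zero =>
    intro s hs
    refine ⟨s, hs, ?_⟩
    have hb := (hbd _ _ hs).mono hBV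
    simpa using Path.single (c := ⟨A.length, s⟩) hget
      (by simp [Instr.exec, hr _ _ hs, hlen]) hb hb
  | succ k ih =>
    intro s hs
    obtain ⟨s', hs', hp⟩ := ih _ (hI k s hs)
    refine ⟨s', hs', ?_⟩
    have hb := (hbd _ _ hs).mono hBV
    have hb' := (hbd _ _ (hI k s hs)).mono hBV
    have p1 : Path (loop A r P) V ⟨A.length, s⟩ 1 ⟨A.length + 1, s⟩ :=
      Path.single hget (by simp [Instr.exec, hr _ _ hs]) hb hb
    have p2 := Path.straight (A ++ [.jumpZero r (A.length + P.length + 2)]) P [.jump A.length]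
      hP hB hPB (hbd _ _ hs) hV
    have p3 : Path (loop A r P) V ⟨A.length + 1 + P.length, runs P s⟩ 1 ⟨A.length, runs P s⟩ :=
      Path.single hget' rfl hb' hb'
    simp only [List.length_append, List.length_singleton] at p2
    have := ((p1.trans p2).trans p3).trans hp
    convert this using 1
    ring

theorem run_loop {A P : Program} {r : ℕ} (hA : ∀ i ∈ A, i.IsStraight)
    (hP : ∀ i ∈ P, i.IsStraight) {B V : ℕ} (hB : 2 ≤ B) (hAB : ∀ i ∈ A, i.ConstLE B)
    (hPB : ∀ i ∈ P, i.ConstLE B) (hVA : B ^ 2 ^ A.length ≤ V) (hV : B ^ 2 ^ P.length ≤ V)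
    (I : ℕ → State → Prop) (hbd : ∀ k s, I k s → s.Bounded B) (hr : ∀ k s, I k s → s.reg r = k)
    (hI : ∀ k s, I (k + 1) s → I k (runs P s)) {s : State} {n : ℕ} (hs : s.Bounded B)
    (hn : I n (runs A s)) :
    ∃ s', I 0 s' ∧ Run (loop A r P) V s (A.length + (n * (P.length + 2) + 1)) s' := by
  obtain ⟨s', hs', hp⟩ := path_loop hP hB hPB hV I hbd hr hI n _ hn (A := A)
  have p := Path.straight [] A ([.jumpZero r (A.length + P.length + 2)] ++ P ++ [.jump A.length])
    hA hB hAB hs hVA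
  simp only [List.nil_append, List.length_nil, zero_add] at p
  refine ⟨s', hs', Path.run (Path.trans ?_ hp) le_rfl⟩
  convert p using 1
  simp [loop]

/-! ### Expressions and assignments -/

/-- Expressions over the registers `0, …, 7` and the main memory. -/
inductive Exp where
  | lit (k : ℕ)
  | reg (r : Fin 8)
  | op (o : ArithOp) (x y : Exp)
  | load (x : Exp)

namespace Exp

/-- The value of an expression. -/
def eval (s : State) : Exp → ℕ
  | lit k => k
  | reg r => s.reg r
  | op o x y => o.apply (x.eval s) (y.eval s)
  | load x => s.mem (x.eval s)

/-- The number of nodes of an expression. -/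
def size : Exp → ℕ
  | lit _ => 1
  | reg _ => 1
  | op _ x y => x.size + y.size + 1
  | load x => x.size + 1

/-- Code that puts the value of an expression into register `d`, and that only changes the
registers `d, d + 1, …, d + size - 1`. -/
def code : Exp → ℕ → Program
  | lit k, d => [.const d k]
  | reg r, d => [.move d r]
  | op o x y, d => x.code d ++ y.code (d + 1) ++ [.arith o d d (d + 1)]
  | load x, d => x.code d ++ [.load d d]

theorem isStraight_code (x : Exp) : ∀ (d : ℕ), ∀ i ∈ x.code d, i.IsStraight := by
  induction x with
  | lit k => simp [code, Instr.IsStraight]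
  | reg r => simp [code, Instr.IsStraight]
  | op o x y hx hy =>
    intro d i hi
    simp only [code, List.mem_append, List.mem_singleton] at hi
    rcases hi with (hi | hi) | rfl
    · exact hx _ _ hi
    · exact hy _ _ hi
    · trivial
  | load x hx =>
    intro d i hi
    simp only [code, List.mem_append, List.mem_singleton] at hi
    rcases hi with hi | rfl
    · exact hx _ _ hi
    · trivial

theorem eval_congr {s s' : State} (hm : s.mem = s'.mem) (hr : ∀ r < 8, s.reg r = s'.reg r)
    (x : Exp) : x.eval s = x.eval s' := by
  induction x with
  | lit k => rfl
  | reg r => exact hr r r.2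
  | op o x y hx hy => simp [eval, hx, hy]
  | load x hx => simp [eval, hx, hm]

/-- The registers from `d` on serve as a stack: the first operand is left in `d`, the code of the
second one works from `d + 1` on and so preserves it. The source registers lie below `8 ≤ d` and are
never touched. -/
theorem runs_code (x : Exp) : ∀ (d : ℕ), 8 ≤ d → ∀ s : State,
    (runs (x.code d) s).mem = s.mem ∧ (runs (x.code d) s).reg d = x.eval s ∧
    ∀ r, r < d ∨ d + x.size ≤ r → (runs (x.code d) s).reg r = s.reg r := by
  induction x with
  | lit k =>
    intro d hd s
    refine ⟨rfl, by simp [code, Instr.act, Instr.exec, State.setReg, eval], fun r hr => ?_⟩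
    have : r ≠ d := by simp only [size] at hr; omega
    simp [code, Instr.act, Instr.exec, State.setReg, this]
  | reg r =>
    intro d hd s
    refine ⟨rfl, by simp [code, Instr.act, Instr.exec, State.setReg, eval], fun r hr => ?_⟩
    have : r ≠ d := by simp only [size] at hr; omega
    simp [code, Instr.act, Instr.exec, State.setReg, this]
  | op o x y hx hy =>
    intro d hd s
    obtain ⟨x1, x2, x3⟩ := hx d hd s
    obtain ⟨y1, y2, y3⟩ := hy (d + 1) (by omega) (runs (x.code d) s)
    have hev : y.eval (runs (x.code d) s) = y.eval s :=
      eval_congr x1 (fun r hr => x3 r (Or.inl (by omega))) y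
    refine ⟨?_, ?_, fun r hr => ?_⟩
    · simp [code, Instr.act, Instr.exec, State.setReg, y1, x1]
    · simp [code, Instr.act, Instr.exec, State.setReg, y2, y3 d (Or.inl (by omega)), x2, hev, eval]
    · simp only [size] at hr
      have : r ≠ d := by omega
      simp [code, Instr.act, Instr.exec, State.setReg, this]
      rw [y3 r (by omega), x3 r (by omega)]
  | load x hx =>
    intro d hd s
    obtain ⟨x1, x2, x3⟩ := hx d hd s
    refine ⟨?_, ?_, fun r hr => ?_⟩
    · simp [code, Instr.act, Instr.exec, State.setReg, x1]
    · simp [code, Instr.act, Instr.exec, State.setReg, x2, x1, eval]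
    · simp only [size] at hr
      have : r ≠ d := by omega
      simp [code, Instr.act, Instr.exec, State.setReg, this]
      rw [x3 r (by omega)]

end Exp

/-- Assignments of the value of an expression to a register or to a memory cell. -/
inductive Cmd where
  | set (r : Fin 8) (x : Exp)
  | store (p x : Exp)

namespace Cmd

/-- The effect of an assignment. -/
def exec : Cmd → State → State
  | set r x, s => s.setReg r (x.eval s)
  | store p x, s => s.setMem (p.eval s) (x.eval s)

/-- An upper bound on the number of auxiliary registers of the code of an assignment. -/
def size : Cmd → ℕ
  | set _ x => x.size
  | store p x => p.size + x.size

/-- The code of an assignment, with auxiliary registers `8, 9, …`. -/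
def code : Cmd → Program
  | set r x => x.code 8 ++ [.move r 8]
  | store p x => p.code 8 ++ x.code 9 ++ [.store 8 9]

/-- The effect of a sequence of assignments. -/
def execs (cs : List Cmd) (s : State) : State := cs.foldl (fun s c => c.exec s) s

/-- The code of a sequence of assignments, which ends by resetting the auxiliary registers. -/
def compile (cs : List Cmd) : Program :=
  cs.flatMap code ++ (List.range (cs.map size).sum).map fun j => .const (8 + j) 0

theorem isStraight_compile (cs : List Cmd) : ∀ i ∈ compile cs, i.IsStraight := by
  intro i hi
  simp only [compile, List.mem_append, List.mem_flatMap, List.mem_map] at hi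
  rcases hi with ⟨c, -, hi⟩ | ⟨j, -, rfl⟩
  · cases c with
    | set r x =>
      simp only [code, List.mem_append, List.mem_singleton] at hi
      rcases hi with hi | rfl
      · exact x.isStraight_code _ _ hi
      · trivial
    | store p x =>
      simp only [code, List.mem_append, List.mem_singleton] at hi
      rcases hi with (hi | hi) | rfl
      · exact p.isStraight_code _ _ hi
      · exact x.isStraight_code _ _ hi
      · trivial
  · trivial

/-- The two states agree on the main memory and on the registers `0, …, 7`. -/
def Agree (s s' : State) : Prop := s.mem = s'.mem ∧ ∀ r < 8, s.reg r = s'.reg r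

theorem runs_code (c : Cmd) {s s' : State} (h : Agree s s') :
    Agree (runs c.code s) (c.exec s') ∧
      ∀ r, 8 + c.size ≤ r → (runs c.code s).reg r = s.reg r := by
  cases c with
  | set r x =>
    obtain ⟨x1, x2, x3⟩ := x.runs_code 8 le_rfl s
    refine ⟨⟨?_, fun q hq => ?_⟩, fun q hq => ?_⟩
    · simp [code, exec, Instr.act, Instr.exec, State.setReg, x1, h.1]
    · by_cases hqr : q = r
      · simp [code, exec, Instr.act, Instr.exec, State.setReg, hqr, x2, Exp.eval_congr h.1 h.2]
      · simp [code, exec, Instr.act, Instr.exec, State.setReg, hqr, x3 q (Or.inl hq), h.2 q hq]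
    · have hqr : q ≠ r := by have := r.2; omega
      simp only [size] at hq
      simp [code, Instr.act, Instr.exec, State.setReg, hqr, x3 q (Or.inr hq)]
  | store p x =>
    obtain ⟨p1, p2, p3⟩ := p.runs_code 8 le_rfl s
    obtain ⟨x1, x2, x3⟩ := x.runs_code 9 (by omega) (runs (p.code 8) s)
    have hev : x.eval (runs (p.code 8) s) = x.eval s :=
      Exp.eval_congr p1 (fun r hr => p3 r (Or.inl hr)) x
    refine ⟨⟨?_, fun q hq => ?_⟩, fun q hq => ?_⟩
    · simp [code, exec, Instr.act, Instr.exec, State.setMem, x1, x2, p1, p2,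
        x3 8 (Or.inl (by omega)), hev, h.1, Exp.eval_congr h.1 h.2]
    · simp [code, exec, Instr.act, Instr.exec, State.setMem, x3 q (Or.inl (by omega)),
        p3 q (Or.inl hq), h.2 q hq]
    · simp only [size] at hq
      -- The code of `x` reaches up to register `8 + x.size`; this lies below `8 + p.size + x.size`
      -- because an expression has at least one node.
      have : 1 ≤ p.size := by cases p <;> simp [Exp.size]
      simp [code, Instr.act, Instr.exec, State.setMem, x3 q (Or.inr (by omega)),
        p3 q (Or.inr (by omega))]

theorem runs_flatMap_code (cs : List Cmd) : ∀ {s s' : State}, Agree s s' →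
    Agree (runs (cs.flatMap code) s) (execs cs s') ∧
      ∀ r, 8 + (cs.map size).sum ≤ r → (runs (cs.flatMap code) s).reg r = s.reg r := by
  induction cs with
  | nil => intro s s' h; simpa [execs] using h
  | cons c cs ih =>
    intro s s' h
    obtain ⟨h1, h2⟩ := c.runs_code h
    obtain ⟨h3, h4⟩ := ih h1
    simp only [List.flatMap_cons, runs_append, List.map_cons, List.sum_cons]
    exact ⟨h3, fun r hr => by rw [h4 r (by omega), h2 r (by omega)]⟩

theorem runs_map_const (l : List ℕ) (s : State) :
    (runs (l.map fun j => .const (8 + j) 0) s).mem = s.mem ∧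
    ∀ r, (runs (l.map fun j => .const (8 + j) 0) s).reg r
      = if ∃ j ∈ l, r = 8 + j then 0 else s.reg r := by
  induction l generalizing s with
  | nil => simp
  | cons j l ih =>
    obtain ⟨h1, h2⟩ := ih ((Instr.const (8 + j) 0).act s)
    simp only [List.map_cons, runs_cons]
    refine ⟨h1, fun r => ?_⟩
    rw [h2]
    by_cases hr : r = 8 + j <;>
      simp [Instr.act, Instr.exec, State.setReg, hr]

theorem execs_reg (cs : List Cmd) : ∀ (s : State) (r : ℕ), 8 ≤ r →
    (execs cs s).reg r = s.reg r := by
  induction cs with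
  | nil => intro s r _; rfl
  | cons c cs ih =>
    intro s r hr
    show (execs cs (c.exec s)).reg r = _
    rw [ih _ r hr]
    cases c with
    | set q x =>
      have : r ≠ q := by have := q.2; omega
      simp [exec, State.setReg, this]
    | store p x => rfl

/-- The final resets make the auxiliary registers invisible, so that compiled code and assignments
produce equal states and not merely agreeing ones. -/
theorem runs_compile (cs : List Cmd) {s : State} (hs : ∀ r, 8 ≤ r → s.reg r = 0) :
    runs (compile cs) s = execs cs s := by
  obtain ⟨⟨h1, h2⟩, h3⟩ := runs_flatMap_code cs (s := s) (s' := s) ⟨rfl, fun _ _ => rfl⟩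
  obtain ⟨h4, h5⟩ := runs_map_const (List.range (cs.map size).sum) (runs (cs.flatMap code) s)
  rw [compile, runs_append]
  ext r
  · rw [h5]
    rcases lt_or_ge r 8 with hr | hr
    · rw [if_neg (by rintro ⟨j, -, rfl⟩; omega), h2 r hr]
    · rw [execs_reg cs s r hr, hs r hr]
      split_ifs with h
      · rfl
      · rw [h3 r, hs r hr]
        by_contra hlt
        exact h ⟨r - 8, by simp; omega, by omega⟩
  · rw [h4, h1]

end Cmd

end RAM

/-! ### Evaluation of words in `ZG` monoids -/

section ZG

variable {M : Type*} [Monoid M]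

/-- An idempotent equals all its positive powers, in particular the central one with exponent `ω +
1`. -/
theorem IsIdempotentElem.commute_of_isZG (hM : IsZG M) {z : M} (hz : IsIdempotentElem z) (y : M) :
    z * y = y * z := by
  have h := hM z y
  rwa [hz.pow_succ_eq] at h

/-- Since `x ^ ω` is idempotent, `x ^ (ω + c + 1)` is the product of `x ^ (ω + c)` and `x ^ (ω +
1)`; centrality follows by induction. -/
theorem pow_idempotentPower_add_commute [Finite M] (hM : IsZG M) (x y : M) (c : ℕ) :
    x ^ (idempotentPower x + c) * y = y * x ^ (idempotentPower x + c) := by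
  have hz := (idempotentPower_spec x).2
  have hc : Commute (x ^ idempotentPower x) y := hz.commute_of_isZG hM y
  have h1 : Commute (x ^ (idempotentPower x + 1)) y := hM x y
  induction c with
  | zero => exact hc
  | succ c ih =>
    have : x ^ (idempotentPower x + (c + 1))
        = x ^ (idempotentPower x + c) * x ^ (idempotentPower x + 1) := by
      conv_lhs => rw [pow_add, ← hz.eq, pow_succ x c]
      rw [pow_add, pow_add, pow_one]
      have := (Commute.refl x).pow_pow (idempotentPower x) c
      simp only [mul_assoc]
      rw [← mul_assoc (x ^ c), ← this.eq, mul_assoc]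
    rw [this]
    exact (Commute.mul_left ih h1).eq

/-- Let `z` be the idempotent power of `a * y`. It fixes `p` on the right, is central, and is a
right multiple of `a`. Hence it is a right multiple of every power of `a`, so `a ^ ω * z = z`, and
multiplying by `p` gives the claim. -/
theorem mul_pow_idempotentPower_of_eq [Finite M] (hM : IsZG M) {p a y : M} (h : p = p * (a * y)) :
    p * a ^ idempotentPower a = p := by
  have hp : ∀ k, p * (a * y) ^ k = p := by
    intro k
    induction k with
    | zero => simp
    | succ k ih => rw [pow_succ', ← mul_assoc, ← h, ih]
  obtain ⟨hpos, hz⟩ := idempotentPower_spec (a * y)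
  set z := (a * y) ^ idempotentPower (a * y) with hzdef
  obtain ⟨y', hy'⟩ : ∃ y', z = a * y' := by
    obtain ⟨k, hk⟩ := Nat.exists_eq_succ_of_ne_zero hpos.ne'
    exact ⟨y * (a * y) ^ k, by rw [hzdef, hk, pow_succ', mul_assoc]⟩
  -- Duplicate `z`, write one copy as `a * y'`, and move the other past `y'`.
  have hk : ∀ k, z = a ^ k * (z * y' ^ k) := by
    intro k
    induction k with
    | zero => simp
    | succ k ih =>
      calc z = a ^ k * (z * y' ^ k) := ih
        _ = a ^ k * (z * z * y' ^ k) := by rw [hz.eq]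
        _ = a ^ k * (a * y' * z * y' ^ k) := by rw [← hy']
        _ = a ^ (k + 1) * (z * y' ^ (k + 1)) := by
          rw [mul_assoc a, ← hz.commute_of_isZG hM y', pow_succ a, pow_succ' y']
          simp only [mul_assoc]
  have ha := (idempotentPower_spec a).2
  have hza : a ^ idempotentPower a * z = z := by
    rw [hk (idempotentPower a), ← mul_assoc, ha.eq]
  calc p * a ^ idempotentPower a = p * z * a ^ idempotentPower a := by rw [hp]
    _ = p * (a ^ idempotentPower a * z) := by rw [mul_assoc, ha.commute_of_isZG hM z]
    _ = p := by rw [hza, hp]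

variable {X : Type*} [DecidableEq X]

/-- The size of the right ideal `pM` serves as a budget for occurrences of `a`: each of them either
makes the ideal strictly smaller, or leaves `p` in `p * φ a * M`, and then `p` absorbs the
idempotent. The ideal is never empty, so the budget cannot be met by an empty word. -/
theorem prod_mul_pow_idempotentPower [Finite M] (hM : IsZG M) (φ : X → M) (a : X) (w : List X) :
    ∀ p : M, (Set.range (p * ·)).ncard ≤ w.count a →
      p * (w.map φ).prod * φ a ^ idempotentPower (φ a) = p * (w.map φ).prod := by
  induction w with
  | nil =>
    intro p hp
    have h0 : 0 < (Set.range (p * ·)).ncard :=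
      (Set.ncard_pos (Set.toFinite _)).2 ⟨p * 1, 1, rfl⟩
    simp at hp; omega
  | cons x w ih =>
    intro p hp
    have hsub : Set.range (p * φ x * ·) ⊆ Set.range (p * ·) := by
      rintro _ ⟨y, rfl⟩; exact ⟨φ x * y, by simp [mul_assoc]⟩
    rw [List.map_cons, List.prod_cons, ← mul_assoc]
    by_cases hx : x = a
    · subst hx
      -- If `p` can be recovered after reading `a`, the rest of the word is irrelevant: the central
      -- idempotent is carried back to `p`, which absorbs it.
      by_cases hpx : p ∈ Set.range (p * φ x * ·)
      · obtain ⟨y, hy⟩ := hpx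
        have hpa := mul_pow_idempotentPower_of_eq hM (p := p) (a := φ x) (y := y)
          (by rw [← mul_assoc]; exact hy.symm)
        have hc := (idempotentPower_spec (φ x)).2.commute_of_isZG hM
        rw [mul_assoc, ← hc, ← mul_assoc, mul_assoc p, ← hc, ← mul_assoc p, hpa]
      · apply ih
        have hlt : (Set.range (p * φ x * ·)).ncard < (Set.range (p * ·)).ncard :=
          Set.ncard_lt_ncard ⟨hsub, fun h => hpx (h ⟨1, by simp⟩)⟩ (Set.toFinite _)
        rw [List.count_cons_self] at hp
        omega
    · apply ih
      rw [List.count_cons_of_ne (by simpa using hx)] at hp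
      exact (Set.ncard_le_ncard hsub (Set.toFinite _)).trans hp

/-- The idempotent moves freely to meet the next letter. If that letter is `a`, it joins the power;
any other letter is passed by the power, which is central. -/
theorem pow_idempotentPower_mul_prod [Finite M] (hM : IsZG M) (φ : X → M) (a : X) (w : List X) :
    φ a ^ idempotentPower (φ a) * (w.map φ).prod
      = φ a ^ (idempotentPower (φ a) + w.count a) * (w.map (Function.update φ a 1)).prod := by
  induction w with
  | nil => simp
  | cons x w ih =>
    have hc := (idempotentPower_spec (φ a)).2.commute_of_isZG hM
    simp only [List.map_cons, List.prod_cons]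
    rw [← mul_assoc, hc, mul_assoc, ih]
    by_cases hx : x = a
    · subst hx
      rw [List.count_cons_self, Function.update_self, one_mul, ← mul_assoc, ← pow_succ', add_assoc]
    · rw [List.count_cons_of_ne (by simpa using hx), Function.update_of_ne hx, ← mul_assoc,
        ← mul_assoc, pow_idempotentPower_add_commute hM]

/-- Letters that occur at least `|M|` times can be moved to the front. -/
theorem prod_eq_pow_mul_prod_update [Finite M] (hM : IsZG M) (φ : X → M) (a : X) (w : List X)
    (hw : Nat.card M ≤ w.count a) :
    (w.map φ).prod
      = φ a ^ (idempotentPower (φ a) + w.count a) * (w.map (Function.update φ a 1)).prod := by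
  rw [← pow_idempotentPower_mul_prod hM,
    (idempotentPower_spec (φ a)).2.commute_of_isZG hM]
  have h := prod_mul_pow_idempotentPower hM φ a w 1
    ((Set.ncard_le_card _).trans hw)
  rw [one_mul] at h
  exact h.symm

/-- All letters of `F` that occur at least `|M|` times can be moved to the front. -/
theorem prod_eq_prod_frequent_mul [Finite M] (hM : IsZG M) (w : List X) :
    ∀ (F : List X) (φ : X → M), F.Nodup → (w.map φ).prod
      = (F.map fun a => if Nat.card M ≤ w.count a
            then φ a ^ (idempotentPower (φ a) + w.count a) else 1).prod
        * (w.map fun x => if x ∈ F ∧ Nat.card M ≤ w.count x then 1 else φ x).prod := by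
  intro F
  induction F with
  | nil => simp
  | cons a F ih =>
    intro φ hF
    obtain ⟨haF, hF⟩ := List.nodup_cons.1 hF
    rw [List.map_cons, List.prod_cons]
    by_cases ha : Nat.card M ≤ w.count a
    -- The word, and with it every count, stays fixed; only `φ` changes, by sending `a` to `1`. This
    -- is why the induction is over all `φ`.
    · rw [prod_eq_pow_mul_prod_update hM φ a w ha, ih _ hF, if_pos ha, mul_assoc]
      congr 2
      · congr 1
        refine List.map_congr_left fun b hb => ?_
        rw [Function.update_of_ne (by rintro rfl; exact haF hb)]
      · congr 1
        refine List.map_congr_left fun x _ => ?_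
        by_cases hx : x = a
        · subst hx; simp [ha]
        · simp [hx]
    · rw [if_neg ha, one_mul, ih φ hF]
      congr 2
      refine List.map_congr_left fun x _ => ?_
      by_cases hx : x = a
      · subst hx; simp [ha]
      · simp [hx]

end ZG

namespace DynamicWord

/-! ### Bags of positions -/

/-- Overwrite one entry of a two-dimensional array. -/
def upd (g : ℕ → ℕ → ℕ) (k i v : ℕ) : ℕ → ℕ → ℕ :=
  fun k' i' => if k' = k ∧ i' = i then v else g k' i'

/-- The rows of the array `g` represent the word `U 0, …, U (n - 1)` over the letters `0, …, m - 1`,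
of which the positions in `S` have been registered: row `0` contains the word, row `2 + a` lists
in any order the registered positions of the letter `a`, and has their number as its entry `n`,
and row `1` contains for every registered position its index in the list of its letter. -/
structure Bags (n m : ℕ) (g : ℕ → ℕ → ℕ) (U : ℕ → ℕ) (S : Set ℕ) : Prop where
  letter : ∀ i ≤ n, g 0 i = U i
  letter_lt : ∀ i ≤ n, U i < m
  bag : ∀ a < m, ∀ j < g (2 + a) n, g (2 + a) j < n ∧ g (2 + a) j ∈ S ∧ U (g (2 + a) j) = a ∧
    g 1 (g (2 + a) j) = j
  pos : ∀ i < n, i ∈ S → g 1 i < g (2 + U i) n ∧ g (2 + U i) (g 1 i) = i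

namespace Bags

variable {n m : ℕ} {g g' : ℕ → ℕ → ℕ} {U : ℕ → ℕ} {S : Set ℕ}

-- Row `2 + a` and row `1` are inverse to each other between list indices and registered positions
-- of `a`.
open Classical in
theorem count_eq (h : Bags n m g U S) {a : ℕ} (ha : a < m) :
    g (2 + a) n = ((Finset.range n).filter fun i => i ∈ S ∧ U i = a).card := by
  rw [← Finset.card_range (g (2 + a) n)]
  refine Finset.card_nbij' (fun j => g (2 + a) j) (fun i => g 1 i) ?_ ?_ ?_ ?_
  · intro j hj
    have := h.bag a ha j (by simpa using hj)
    simp [this]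
  · intro i hi
    simp only [Finset.coe_filter, Finset.mem_range, Set.mem_ofPred_eq] at hi
    have := h.pos i hi.1 hi.2.1
    rw [hi.2.2] at this
    simp [this]
  · intro j hj
    exact (h.bag a ha j (by simpa using hj)).2.2.2
  · intro i hi
    simp only [Finset.coe_filter, Finset.mem_range, Set.mem_ofPred_eq] at hi
    have := h.pos i hi.1 hi.2.1
    rw [hi.2.2] at this
    exact this.2

theorem count_le (h : Bags n m g U S) {a : ℕ} (ha : a < m) : g (2 + a) n ≤ n := by
  classical
  rw [h.count_eq ha]
  exact (Finset.card_filter_le _ _).trans (by simp)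

/-- An unregistered position leaves room in every list, so appending an entry does not overwrite the
counter in column `n`. -/
theorem count_lt (h : Bags n m g U S) {a i : ℕ} (ha : a < m) (hi : i < n) (hS : i ∉ S) :
    g (2 + a) n < n := by
  classical
  rw [h.count_eq ha]
  conv_rhs => rw [← Finset.card_range n]
  refine Finset.card_lt_card ⟨Finset.filter_subset _ _, fun hs => ?_⟩
  have := hs (Finset.mem_range.2 hi)
  simp [hS] at this

theorem congr (h : Bags n m g U S) (hg : ∀ k, ∀ i ≤ n, g' k i = g k i) : Bags n m g' U S := by
  refine ⟨fun i hi => by rw [hg _ _ hi, h.letter i hi], h.letter_lt, fun a ha j hj => ?_,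
    fun i hi hS => ?_⟩
  · rw [hg _ _ le_rfl] at hj
    have h1 := h.bag a ha j hj
    have h2 := h.count_le ha
    rw [hg _ _ (by omega), hg _ _ h1.1.le]
    exact h1
  · have h1 := h.pos i hi hS
    have h2 := h.count_le (h.letter_lt i hi.le)
    rw [hg _ _ le_rfl, hg _ _ hi.le, hg _ _ (by omega)]
    exact h1

/-- The array after registering the position `i` with the letter `a`. -/
def insertArray (n : ℕ) (g : ℕ → ℕ → ℕ) (i a : ℕ) : ℕ → ℕ → ℕ :=
  upd (upd (upd (upd g (2 + a) (g (2 + a) n) i) 1 i (g (2 + a) n)) (2 + a) n (g (2 + a) n + 1)) 0 i a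

/-- The array after unregistering the position `i`. -/
def removeArray (n : ℕ) (g : ℕ → ℕ → ℕ) (i : ℕ) : ℕ → ℕ → ℕ :=
  upd (upd (upd g (2 + g 0 i) (g 1 i) (g (2 + g 0 i) (g (2 + g 0 i) n - 1)))
    1 (g (2 + g 0 i) (g (2 + g 0 i) n - 1)) (g 1 i)) (2 + g 0 i) n (g (2 + g 0 i) n - 1)

theorem insert (h : Bags n m g U S) {i a : ℕ} (hi : i < n) (hS : i ∉ S) (ha : a < m) :
    Bags n m (insertArray n g i a) (Function.update U i a) (insert i S) := by
  have hc := h.count_lt ha hi hS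
  have h1 := h.letter
  have h2 := h.letter_lt
  have h3 := h.bag
  have h4 := h.pos
  have h5 := fun a ha => h.count_le (a := a) ha
  refine ⟨?_, ?_, ?_, ?_⟩
  · intro x hx
    simp only [insertArray, upd, Function.update_apply]
    grind
  · intro x hx
    simp only [Function.update_apply]
    grind
  · intro b hb j hj
    simp only [insertArray, upd, Function.update_apply, Set.mem_insert_iff] at hj ⊢
    have := h3 b hb j
    have := h5 b hb
    grind
  · intro x hx hxS
    simp only [insertArray, upd, Function.update_apply, Set.mem_insert_iff] at hxS ⊢
    have := h4 x hx
    have := h5 (U x) (h2 x hx.le)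
    grind

/-- The last position `l` of the list takes over the index `q` of the removed position `i`, and the
list is shortened by one. If `l = i`, the two writes fall on an entry that is cut off and on a
position that is no longer registered. -/
theorem remove (h : Bags n m g U S) {i : ℕ} (hi : i < n) (hS : i ∈ S) :
    Bags n m (removeArray n g i) U (S \ {i}) := by
  have h1 := h.letter
  have h2 := h.letter_lt
  have h3 := h.bag
  have h4 := h.pos
  have h5 := fun a ha => h.count_le (a := a) ha
  rw [removeArray, h1 i hi.le]
  have hp := h4 i hi hS
  have hb := h2 i hi.le
  have hn := h5 _ hb
  have hl := h3 _ hb (g (2 + U i) n - 1) (by omega)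
  generalize hcdef : g (2 + U i) n - 1 = c at *
  generalize hldef : g (2 + U i) c = l at *
  generalize hqdef : g 1 i = q at *
  refine ⟨?_, ?_, ?_, ?_⟩
  · intro x hx
    simp only [upd]
    grind
  · exact h2
  · intro b hb j hj
    simp only [upd, Set.mem_sdiff, Set.mem_singleton_iff] at hj ⊢
    have := h3 b hb j
    have := h5 b hb
    grind
  · intro x hx hxS
    simp only [upd, Set.mem_sdiff, Set.mem_singleton_iff] at hxS ⊢
    have := h4 x hx hxS.1
    have := h5 (U x) (h2 x hx.le)
    grind

end Bags

end DynamicWord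

namespace RAM.Exp

/-! ### Compound expressions -/

/-- The sum of two expressions. -/
def add (x y : Exp) : Exp := op .add x y

/-- The truncated difference of two expressions. -/
def sub (x y : Exp) : Exp := op .sub x y

/-- The product of two expressions. -/
def mul (x y : Exp) : Exp := op .mul x y

/-- The remainder of two expressions. -/
def mod (x y : Exp) : Exp := op .mod x y

/-- `if x < y then a else b`. -/
def iteLT (x y a b : Exp) : Exp :=
  add (mul (sub (lit 1) (sub (lit 1) (sub y x))) a) (mul (sub (lit 1) (sub y x)) b)

/-- The minimum of two expressions. -/
def min (x y : Exp) : Exp := iteLT x y x y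

/-- The value `f x` of a function, given by a table for arguments less than `B`. -/
def table (f : ℕ → ℕ) : ℕ → Exp → Exp
  | 0, _ => lit 0
  | B + 1, x => add (table f B x)
      (mul (sub (lit 1) (add (sub x (lit B)) (sub (lit B) x))) (lit (f B)))

variable (s : State) (x y a b : Exp)

@[simp] theorem eval_lit (k : ℕ) : (lit k).eval s = k := rfl
@[simp] theorem eval_reg (r : Fin 8) : (reg r).eval s = s.reg r := rfl
@[simp] theorem eval_load : (load x).eval s = s.mem (x.eval s) := rfl
@[simp] theorem eval_add : (add x y).eval s = x.eval s + y.eval s := rfl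
@[simp] theorem eval_sub : (sub x y).eval s = x.eval s - y.eval s := rfl
@[simp] theorem eval_mul : (mul x y).eval s = x.eval s * y.eval s := rfl
@[simp] theorem eval_mod : (mod x y).eval s = x.eval s % y.eval s := rfl

-- With truncated subtraction, `1 - (y - x)` is the indicator of `y ≤ x`. Case distinctions thus
-- need no jumps, and the code remains straight-line.
@[simp] theorem eval_iteLT :
    (iteLT x y a b).eval s = if x.eval s < y.eval s then a.eval s else b.eval s := by
  simp only [iteLT, eval_add, eval_mul, eval_sub, eval_lit]
  split_ifs with h
  · rw [show 1 - (y.eval s - x.eval s) = 0 by omega]; simp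
  · rw [show y.eval s - x.eval s = 0 by omega]; simp

@[simp] theorem eval_min : (min x y).eval s = Min.min (x.eval s) (y.eval s) := by
  simp only [min, eval_iteLT]
  split_ifs <;> omega

/-- Here `1 - ((x - B) + (B - x))` is the indicator of `x = B`, so at most one summand survives. -/
theorem eval_table (f : ℕ → ℕ) (B : ℕ) :
    (table f B x).eval s = if x.eval s < B then f (x.eval s) else 0 := by
  induction B with
  | zero => simp [table]
  | succ B ih =>
    simp only [table, eval_add, eval_mul, eval_sub, eval_lit, ih]
    rcases lt_trichotomy (x.eval s) B with h | h | h
    · rw [if_pos h, if_pos (by omega), show 1 - (x.eval s - B + (B - x.eval s)) = 0 by omega]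
      simp
    · simp [h]
    · rw [if_neg (by omega), if_neg (by omega),
        show 1 - (x.eval s - B + (B - x.eval s)) = 0 by omega]
      simp

end RAM.Exp

namespace DynamicWord

open RAM

/-! ### Memory layout and updates -/

/-- The address of entry `i` of row `k`, where register `2` contains the length of the rows. -/
def cell (k i : Exp) : Exp := .add (.mul k (.reg 2)) i

/-- The length of the word. -/
def len : Exp := .sub (.reg 2) (.lit 1)

/-- The number of registered positions of the letter `a`. -/
def count (a : Exp) : Exp := .load (cell (.add (.lit 2) a) len)

/-- Register the position in register `0` with the letter in register `1`. -/
def insertCmds : List Cmd :=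
  [.set 4 (count (.reg 1)),
   .store (cell (.add (.lit 2) (.reg 1)) (.reg 4)) (.reg 0),
   .store (cell (.lit 1) (.reg 0)) (.reg 4),
   .store (cell (.add (.lit 2) (.reg 1)) len) (.add (.reg 4) (.lit 1)),
   .store (cell (.lit 0) (.reg 0)) (.reg 1),
   .set 4 (.lit 0)]

/-- Unregister the position in register `0`. -/
def removeCmds : List Cmd :=
  [.set 3 (.load (cell (.lit 0) (.reg 0))),
   .set 4 (.sub (count (.reg 3)) (.lit 1)),
   .set 5 (.load (cell (.lit 1) (.reg 0))),
   .set 6 (.load (cell (.add (.lit 2) (.reg 3)) (.reg 4))),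
   .store (cell (.add (.lit 2) (.reg 3)) (.reg 5)) (.reg 6),
   .store (cell (.lit 1) (.reg 6)) (.reg 5),
   .store (cell (.add (.lit 2) (.reg 3)) len) (.reg 4),
   .set 3 (.lit 0), .set 4 (.lit 0), .set 5 (.lit 0), .set 6 (.lit 0)]

/-- The main memory as an array with rows of length `n + 1`. -/
def array (n : ℕ) (s : State) (k i : ℕ) : ℕ := s.mem (k * (n + 1) + i)

theorem address_inj {n k i k' i' : ℕ} (hi : i ≤ n) (hi' : i' ≤ n)
    (h : k * (n + 1) + i = k' * (n + 1) + i') : k = k' ∧ i = i' := by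
  have hk : k = k' := by
    have := congrArg (· / (n + 1)) h
    simpa [Nat.mul_comm _ (n + 1), Nat.mul_add_div, Nat.div_eq_of_lt (Nat.lt_succ_of_le hi),
      Nat.div_eq_of_lt (Nat.lt_succ_of_le hi')] using this
  subst hk
  exact ⟨rfl, by omega⟩

theorem array_setMem {n : ℕ} {s : State} {g : ℕ → ℕ → ℕ} (h : ∀ k, ∀ i ≤ n, array n s k i = g k i)
    {k i : ℕ} (hi : i ≤ n) (v : ℕ) : ∀ k', ∀ i' ≤ n,
      array n (s.setMem (k * (n + 1) + i) v) k' i' = upd g k i v k' i' := by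
  intro k' i' hi'
  simp only [array, State.setMem, Function.update_apply, upd]
  by_cases heq : k' = k ∧ i' = i
  · rw [if_pos heq, if_pos (by rw [heq.1, heq.2])]
  · rw [if_neg heq, if_neg fun hh => heq (address_inj hi' hi hh)]
    exact h k' i' hi'

theorem execs_insertCmds {n : ℕ} {s : State} (h2 : s.reg 2 = n + 1) :
    Cmd.execs insertCmds s =
      (((((s.setMem ((2 + s.reg 1) * (n + 1) + array n s (2 + s.reg 1) n) (s.reg 0)).setMem
        (1 * (n + 1) + s.reg 0) (array n s (2 + s.reg 1) n)).setMem
        ((2 + s.reg 1) * (n + 1) + n) (array n s (2 + s.reg 1) n + 1)).setMem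
        (0 * (n + 1) + s.reg 0) (s.reg 1)).setReg 4 0) := by
  simp [Cmd.execs, insertCmds, Cmd.exec, cell, count, len, State.setReg, State.setMem, h2, array]

/-- All loads precede the first store, so the four values `b`, `c`, `q`, `l` refer to the initial
array. -/
theorem execs_removeCmds {n : ℕ} {s : State} (h2 : s.reg 2 = n + 1) {b c q l : ℕ}
    (hb : b = array n s 0 (s.reg 0)) (hc : c = array n s (2 + b) n - 1)
    (hq : q = array n s 1 (s.reg 0)) (hl : l = array n s (2 + b) c) :
    Cmd.execs removeCmds s =
      ((((((s.setMem ((2 + b) * (n + 1) + q) l).setMem (1 * (n + 1) + l) q).setMem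
        ((2 + b) * (n + 1) + n) c).setReg 3 0).setReg 4 0).setReg 5 0).setReg 6 0 := by
  subst hl hc hq hb
  simp [Cmd.execs, removeCmds, Cmd.exec, cell, count, len, State.setReg, State.setMem, h2, array]
  ext r
  simp [Function.update_apply]
  grind

variable {M : Type*} [Monoid M]

/-- The codes of the letters of a word, extended by the code of `1`. -/
def codes (e : M ≃ Fin (Nat.card M)) {n : ℕ} (u : Fin n → M) (i : ℕ) : ℕ :=
  if h : i < n then e (u ⟨i, h⟩) else e 1

theorem codes_update (e : M ≃ Fin (Nat.card M)) {n : ℕ} (u : Fin n → M) (i : Fin n) (a : M) :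
    codes e (Function.update u i a) = Function.update (codes e u) i (e a) := by
  ext j
  by_cases hj : j = i
  · subst hj; simp [codes]
  · rw [Function.update_of_ne hj]
    unfold codes
    split_ifs with h
    · rw [Function.update_of_ne (fun h' => hj (by rw [← h']))]
    · rfl

/-- The state `s` represents the word `u`, of which the positions in `S` have been registered.
Register `7` contains `k`, and no cell exceeds `B`. -/
structure Represents (e : M ≃ Fin (Nat.card M)) (B : ℕ) {n : ℕ} (s : State) (u : Fin n → M)
    (S : Set ℕ) (k : ℕ) : Prop where
  reg_two : s.reg 2 = n + 1
  reg_seven : s.reg 7 = k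
  reg_eq_zero : ∀ r, 3 ≤ r → r ≠ 7 → s.reg r = 0
  bounded : s.Bounded B
  bags : Bags n (Nat.card M) (array n s) (codes e u) S

namespace Represents

variable {e : M ≃ Fin (Nat.card M)} {B n : ℕ} {s : State} {u : Fin n → M} {S : Set ℕ} {k : ℕ}

/-- Registers `0` and `1` are left free by the invariant, because they carry the inputs and outputs
of the operations. -/
theorem setReg (h : Represents e B s u S k) {r v : ℕ} (hr : r < 2) (hv : v ≤ B) :
    Represents e B (s.setReg r v) u S k := by
  refine ⟨?_, ?_, fun q hq hq7 => ?_, h.bounded.setReg hv, h.bags⟩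
  · simpa [State.setReg, Function.update_of_ne (show 2 ≠ r by omega)] using h.reg_two
  · simpa [State.setReg, Function.update_of_ne (show 7 ≠ r by omega)] using h.reg_seven
  · simpa [State.setReg, Function.update_of_ne (show q ≠ r by omega)] using h.reg_eq_zero q hq hq7

theorem insert (h : Represents e B s u S k) (hB : n ≤ B) {i : Fin n} {a : M} (hi : s.reg 0 = i)
    (ha : s.reg 1 = e a) (hS : (i : ℕ) ∉ S) :
    Represents e B (Cmd.execs insertCmds s) (Function.update u i a) (insert (i : ℕ) S) k := by
  have hc := h.bags.count_lt (e a).2 i.2 hS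
  have hbd := h.bounded
  rw [execs_insertCmds h.reg_two, hi, ha]
  refine ⟨?_, ?_, fun q hq hq7 => ?_, ?_, ?_⟩
  · simpa [State.setReg, State.setMem] using h.reg_two
  · simpa [State.setReg, State.setMem] using h.reg_seven
  · by_cases h4 : q = 4
    · simp [State.setReg, State.setMem, h4]
    · simpa [State.setReg, State.setMem, h4] using h.reg_eq_zero q hq hq7
  · refine State.Bounded.setReg (.setMem (.setMem (.setMem (.setMem hbd ?_) ?_) ?_) ?_) (by simp)
    · rw [← hi]; exact hbd.1 0
    · omega
    · omega
    · rw [← ha]; exact hbd.1 1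
  · rw [codes_update]
    refine (h.bags.insert i.2 hS (e a).2).congr ?_
    exact array_setMem (array_setMem (array_setMem (array_setMem (fun _ _ _ => rfl) hc.le _)
      i.2.le _) le_rfl _) i.2.le _

theorem remove (h : Represents e B s u S k) {i : Fin n} (hi : s.reg 0 = i) (hS : (i : ℕ) ∈ S) :
    Represents e B (Cmd.execs removeCmds s) u (S \ {(i : ℕ)}) k := by
  have hbd := h.bounded
  rw [execs_removeCmds h.reg_two rfl rfl rfl rfl, hi]
  have hL := h.bags.letter i i.2.le
  have hp := h.bags.pos i i.2 hS
  rw [← hL] at hp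
  have hlt : array n s 0 i < Nat.card M := hL ▸ h.bags.letter_lt i i.2.le
  have hc := h.bags.count_le hlt
  have hl := h.bags.bag _ hlt (array n s (2 + array n s 0 i) n - 1) (by omega)
  refine ⟨?_, ?_, fun q hq hq7 => ?_, ?_, ?_⟩
  · simpa [State.setReg, State.setMem] using h.reg_two
  · simpa [State.setReg, State.setMem] using h.reg_seven
  · by_cases h3 : q = 3 ∨ q = 4 ∨ q = 5 ∨ q = 6
    · rcases h3 with h3 | h3 | h3 | h3 <;> simp [State.setReg, State.setMem, h3]
    · push Not at h3
      simpa [State.setReg, State.setMem, h3] using h.reg_eq_zero q hq hq7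
  · refine State.Bounded.setReg (.setReg (.setReg (.setReg (.setMem (.setMem (.setMem hbd ?_) ?_)
      ?_) ?_) ?_) ?_) ?_
    · exact hbd.2 _
    · exact hbd.2 _
    · exact (Nat.sub_le _ _).trans (hbd.2 _)
    all_goals simp
  · refine (h.bags.remove i.2 hS).congr ?_
    exact array_setMem (array_setMem (array_setMem (fun _ _ _ => rfl) (by omega) _) hl.1.le _)
      le_rfl _

end Represents

end DynamicWord

namespace DynamicWord

open RAM

/-! ### Queries -/

section Decode

variable {M : Type*} [Monoid M] (e : M ≃ Fin (Nat.card M))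

/-- The element of `M` with a given code. -/
noncomputable def decode (x : ℕ) : M := if h : x < Nat.card M then e.symm ⟨x, h⟩ else 1

@[simp] theorem decode_coe (a : M) : decode e (e a) = a := by simp [decode]

theorem coe_decode {x : ℕ} (hx : x < Nat.card M) : (e (decode e x) : ℕ) = x := by
  simp [decode, hx]

/-- The product in `M` of two expressions. -/
noncomputable def mulExp (x y : Exp) : Exp :=
  Exp.table (fun z => e (decode e (z / Nat.card M) * decode e (z % Nat.card M)))
    (Nat.card M * Nat.card M) (.add (.mul x (.lit (Nat.card M))) y)

/-- A pair of codes is packed into one number in base `|M|`, so that the multiplication table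
becomes a table in one argument. -/
theorem eval_mulExp {s : State} {x y : Exp} {a b : M} (hx : x.eval s = e a) (hy : y.eval s = e b) :
    (mulExp e x y).eval s = e (a * b) := by
  have ha := (e a).2
  have hb := (e b).2
  have hpos : 0 < Nat.card M := by omega
  rw [mulExp, Exp.eval_table]
  simp only [Exp.eval_add, Exp.eval_mul, Exp.eval_lit, hx, hy]
  rw [if_pos (by nlinarith), mul_comm, Nat.mul_add_div hpos, Nat.mul_add_mod,
    Nat.div_eq_of_lt hb, Nat.mod_eq_of_lt hb, add_zero, decode_coe, decode_coe]

end Decode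

/-! #### Frequent letters -/

section Frequent

variable {M : Type*} [Monoid M]

/-- From exponent `ω` on, powers are periodic with period `ω`. The unbounded count of a frequent
letter therefore enters only through its residue, which a finite table can handle. -/
theorem pow_idempotentPower_add_mod [Finite M] (x : M) (c : ℕ) :
    x ^ (idempotentPower x + c % idempotentPower x) = x ^ (idempotentPower x + c) := by
  have hz := (idempotentPower_spec x).2
  have hk : ∀ k, x ^ (idempotentPower x + idempotentPower x * k) = x ^ idempotentPower x := by
    intro k
    rw [← mul_one_add, pow_mul, add_comm, hz.pow_succ_eq]
  conv_rhs => rw [← Nat.div_add_mod c (idempotentPower x), ← add_assoc, pow_add, hk, ← pow_add]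

variable (e : M ≃ Fin (Nat.card M))

/-- The contribution of the letter with code `a`, if it is frequent. -/
noncomputable def frequentTerm (a c : ℕ) : M :=
  if Nat.card M ≤ c then decode e a ^ (idempotentPower (decode e a) + c) else 1

/-- The expression for `frequentTerm`. -/
noncomputable def frequentTermExp (a : ℕ) : Exp :=
  Exp.table (fun z => e (if z = 0 then 1 else
      decode e a ^ (idempotentPower (decode e a) + (z - 1))))
    (idempotentPower (decode e a) + 1)
    (.iteLT (count (.lit a)) (.lit (Nat.card M)) (.lit 0)
      (.add (.lit 1) (.mod (count (.lit a)) (.lit (idempotentPower (decode e a))))))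

theorem eval_count {n : ℕ} {s : State} (h2 : s.reg 2 = n + 1) (a : ℕ) :
    (count (.lit a)).eval s = array n s (2 + a) n := by
  simp [count, cell, len, h2, array]

/-- Table index `0` stands for a letter that is not frequent; a residue `r` has index `r + 1`. -/
theorem eval_frequentTermExp [Finite M] {n : ℕ} {s : State} (h2 : s.reg 2 = n + 1) (a : ℕ) :
    (frequentTermExp e a).eval s = e (frequentTerm e a (array n s (2 + a) n)) := by
  have hpos := (idempotentPower_spec (decode e a)).1
  rw [frequentTermExp, Exp.eval_table]
  simp only [Exp.eval_iteLT, eval_count h2, Exp.eval_lit, Exp.eval_add, Exp.eval_mod]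
  by_cases hc : array n s (2 + a) n < Nat.card M
  · simp [hc, frequentTerm, not_le.2 hc]
  · have := Nat.mod_lt (array n s (2 + a) n) hpos
    rw [if_neg hc, if_pos (by omega), if_neg (by omega), frequentTerm, if_pos (by omega),
      Nat.add_sub_cancel_left, pow_idempotentPower_add_mod]

/-- The product of the contributions of the frequent letters. -/
noncomputable def frequentExp (l : List ℕ) : Exp :=
  l.foldr (fun a x => mulExp e (frequentTermExp e a) x) (.lit (e 1))

theorem eval_frequentExp [Finite M] {n : ℕ} {s : State} (h2 : s.reg 2 = n + 1) (l : List ℕ) :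
    (frequentExp e l).eval s
      = e (l.map fun a => frequentTerm e a (array n s (2 + a) n)).prod := by
  induction l with
  | nil => rfl
  | cons a l ih =>
    rw [List.map_cons, List.prod_cons]
    exact eval_mulExp e (eval_frequentTermExp e h2 a) ih

end Frequent

/-! #### Rare letters -/

/-- Entry `j` of the list of positions of the letter `a`, if this entry exists and `a` occurs less
than `K` times, and the length of the word otherwise. -/
def slot (K a j : ℕ) : Exp :=
  .iteLT (.lit j) (count (.lit a))
    (.iteLT (count (.lit a)) (.lit K) (.load (cell (.lit (2 + a)) (.lit j))) len) len

/-- All slots of the letters `0, …, K - 1`. -/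
def slots (K : ℕ) : List Exp :=
  (List.range K).flatMap fun a => (List.range K).map fun j => slot K a j

/-- The least value at least `p` in a list of expressions, or the length of the word. -/
def next (l : List Exp) (p : Exp) : Exp :=
  l.foldr (fun v x => .min (.iteLT v p len v) x) len

theorem eval_len {n : ℕ} {s : State} (h2 : s.reg 2 = n + 1) : len.eval s = n := by
  simp [len, h2]

/-- The value `n` means that nothing was found. Candidates below `p` are replaced by `n`, which
cannot affect the minimum of the others. -/
theorem eval_next {n : ℕ} {s : State} (h2 : s.reg 2 = n + 1) (l : List Exp) (p : Exp) :
    (next l p).eval s ≤ n ∧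
    ((next l p).eval s < n → p.eval s ≤ (next l p).eval s ∧
      ∃ v ∈ l, v.eval s = (next l p).eval s) ∧
    ∀ v ∈ l, p.eval s ≤ v.eval s → (next l p).eval s ≤ v.eval s := by
  induction l with
  | nil => simp [next, eval_len h2]
  | cons v l ih =>
    obtain ⟨h3, h4, h5⟩ := ih
    have hev : (next (v :: l) p).eval s
        = min (if v.eval s < p.eval s then n else v.eval s) ((next l p).eval s) := by
      simp [next, eval_len h2]
    rw [hev]
    generalize (next l p).eval s = q at *
    refine ⟨by omega, fun hlt => ?_, fun w hw hpw => ?_⟩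
    · by_cases hq : q < n ∧ q ≤ (if v.eval s < p.eval s then n else v.eval s)
      · rw [min_eq_right hq.2]
        obtain ⟨h6, w, hw, h7⟩ := h4 hq.1
        exact ⟨h6, w, by simp [hw], h7⟩
      · split_ifs at hq hlt ⊢ with hv
        · omega
        · rw [min_eq_left (by omega)]
          exact ⟨by omega, v, by simp, rfl⟩
    · rcases List.mem_cons.1 hw with rfl | hw
      · rw [if_neg (by omega)]; omega
      · have := h5 w hw hpw; omega

/-- The position `i` contains a letter that occurs less than `K` times. -/
def Rare (n K : ℕ) (g : ℕ → ℕ → ℕ) (U : ℕ → ℕ) (i : ℕ) : Prop := i < n ∧ g (2 + U i) n < K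

theorem slots_spec {n K : ℕ} {s : State} {U : ℕ → ℕ} (h2 : s.reg 2 = n + 1)
    (h : Bags n K (array n s) U Set.univ) :
    (∀ v ∈ slots K, v.eval s < n → Rare n K (array n s) U (v.eval s)) ∧
    ∀ i, Rare n K (array n s) U i → ∃ v ∈ slots K, v.eval s = i := by
  have hev : ∀ a j, (slot K a j).eval s = if j < array n s (2 + a) n then
      if array n s (2 + a) n < K then array n s (2 + a) j else n else n := by
    intro a j
    simp [slot, eval_count h2, eval_len h2, cell, h2]
    rfl
  constructor
  · intro v hv hlt
    simp only [slots, List.mem_flatMap, List.mem_map, List.mem_range] at hv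
    obtain ⟨a, ha, j, hj, rfl⟩ := hv
    rw [hev] at hlt ⊢
    split_ifs at hlt ⊢ with h3 h4
    · have := h.bag a ha j h3
      exact ⟨hlt, by rw [this.2.2.1]; exact h4⟩
    · omega
    · omega
  · rintro i ⟨hi, hiK⟩
    have := h.pos i hi trivial
    refine ⟨slot K (U i) (array n s 1 i), ?_, ?_⟩
    · simp only [slots, List.mem_flatMap, List.mem_map, List.mem_range]
      exact ⟨U i, h.letter_lt i hi.le, _, by omega, rfl⟩
    · rw [hev, if_pos this.1, if_pos hiK, this.2]

-- A position is determined by its letter and its index in the list of that letter, and for rare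
-- positions both are less than `K`.
open Classical in
theorem card_rare_le {n K : ℕ} {g : ℕ → ℕ → ℕ} {U : ℕ → ℕ} (h : Bags n K g U Set.univ) :
    ((Finset.range n).filter (Rare n K g U)).card ≤ K * K := by
  have : K * K = (Finset.range K ×ˢ Finset.range K).card := by simp
  rw [this]
  refine Finset.card_le_card_of_injOn (fun i => (U i, g 1 i)) ?_ ?_
  · intro i hi
    simp only [Finset.coe_filter, Finset.mem_range, Set.mem_ofPred_eq] at hi
    have := h.pos i hi.1 trivial
    have := hi.2.2
    simp only [Finset.coe_product, Set.mem_prod, Finset.coe_range, Set.mem_Iio]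
    exact ⟨h.letter_lt i hi.1.le, by omega⟩
  · intro i hi j hj hij
    simp only [Finset.coe_filter, Finset.mem_range, Set.mem_ofPred_eq] at hi hj
    have h1 := (h.pos i hi.1 trivial).2
    have h2 := (h.pos j hj.1 trivial).2
    simp only [Prod.mk.injEq] at hij
    rw [← h1, ← h2, hij.1, hij.2]

/-! ### Scanning the rare positions in increasing order -/

section

variable {M : Type*} [Monoid M] (e : M ≃ Fin (Nat.card M))

/-- After `k` rounds, the next position to be considered, and the product of the rare letters
before this position. -/
noncomputable def scan : ℕ → Exp × Exp
  | 0 => (.lit 0, .lit (e 1))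
  | k + 1 => (.add (next (slots (Nat.card M)) (scan k).1) (.lit 1),
      mulExp e (scan k).2 (.load (next (slots (Nat.card M)) (scan k).1)))

open Classical in
/-- The contribution of position `i` to the product of the rare letters. -/
noncomputable def rareTerm (n : ℕ) (g : ℕ → ℕ → ℕ) (U : ℕ → ℕ) (i : ℕ) : M :=
  if Rare n (Nat.card M) g U i then decode e (U i) else 1

/-- The product of the rare letters before position `p`. -/
noncomputable def rareProd (n : ℕ) (g : ℕ → ℕ → ℕ) (U : ℕ → ℕ) (p : ℕ) : M :=
  ((List.range p).map (rareTerm e n g U)).prod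

theorem rareProd_succ (n : ℕ) (g : ℕ → ℕ → ℕ) (U : ℕ → ℕ) (p : ℕ) :
    rareProd e n g U (p + 1) = rareProd e n g U p * rareTerm e n g U p := by
  simp [rareProd, List.range_succ]

theorem rareProd_eq {n : ℕ} {g : ℕ → ℕ → ℕ} {U : ℕ → ℕ} {p q : ℕ} (hpq : p ≤ q)
    (h : ∀ i, p ≤ i → i < q → ¬ Rare n (Nat.card M) g U i) :
    rareProd e n g U q = rareProd e n g U p := by
  induction q, hpq using Nat.le_induction with
  | base => rfl
  | succ q hpq ih =>
    rw [rareProd_succ, ih fun i hi hiq => h i hi (by omega), rareTerm,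
      if_neg (h q hpq (by omega)), mul_one]

-- Each round either passes one more rare position or ends at `n + 1`, where the scan stays. Further
-- rounds are harmless, since they read the sentinel letter `1` at position `n`.
open Classical in
theorem eval_scan {n : ℕ} {s : State} {U : ℕ → ℕ} (h2 : s.reg 2 = n + 1)
    (h : Bags n (Nat.card M) (array n s) U Set.univ) (hU : U n = e 1) (k : ℕ) :
    (scan e k).2.eval s = e (rareProd e n (array n s) U ((scan e k).1.eval s)) ∧
    ((scan e k).1.eval s = n + 1 ∨ (scan e k).1.eval s ≤ n ∧
      k ≤ ((Finset.range ((scan e k).1.eval s)).filter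
        (Rare n (Nat.card M) (array n s) U)).card) := by
  obtain ⟨hs1, hs2⟩ := slots_spec h2 h
  have hnot : ¬ Rare n (Nat.card M) (array n s) U n := fun hn => lt_irrefl _ hn.1
  have hWn : rareTerm e n (array n s) U n = 1 := if_neg hnot
  induction k with
  | zero => exact ⟨rfl, Or.inr ⟨Nat.zero_le _, Nat.zero_le _⟩⟩
  | succ k ih =>
    obtain ⟨ih1, ih2⟩ := ih
    obtain ⟨h3, h4, h5⟩ := eval_next h2 (slots (Nat.card M)) (scan e k).1
    -- Row `0` starts at address `0`, so a position is itself the address of its letter.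
    have hload : (Exp.load (next (slots (Nat.card M)) (scan e k).1)).eval s
        = e (decode e (U ((next (slots (Nat.card M)) (scan e k).1).eval s))) := by
      rw [coe_decode e (h.letter_lt _ h3), Exp.eval_load]
      simpa [array] using h.letter _ h3
    have hx := eval_mulExp e ih1 hload
    simp only [scan, Exp.eval_add, Exp.eval_lit]
    rw [hx]
    generalize (next (slots (Nat.card M)) (scan e k).1).eval s = q at *
    generalize (scan e k).1.eval s = p at *
    have hdec : decode e (U q) = rareTerm e n (array n s) U q := by
      rcases h3.lt_or_eq with hq | rfl
      · obtain ⟨-, v, hv, hvq⟩ := h4 hq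
        have := hs1 v hv (by omega)
        rw [hvq] at this
        exact (if_pos this).symm
      · rw [hU, hWn, decode_coe]
    rw [hdec]
    have hskip : ∀ i, p ≤ i → i < q → ¬ Rare n (Nat.card M) (array n s) U i := by
      intro i hpi hiq hi
      obtain ⟨v, hv, rfl⟩ := hs2 i hi
      have := h5 v hv hpi
      omega
    constructor
    · rcases le_or_gt p q with hpq | hpq
      · rw [rareProd_succ, rareProd_eq e hpq hskip]
      -- The search returned a value below its starting point: the scan was already at `n + 1`, and
      -- the letter read is the sentinel.
      · have hqn : ¬ q < n := fun hq => by have := (h4 hq).1; omega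
        obtain rfl : q = n := by omega
        obtain rfl : p = q + 1 := by omega
        rw [hWn, mul_one]
    · rcases h3.lt_or_eq with hq | rfl
      · right
        obtain ⟨hpq, v, hv, hvq⟩ := h4 hq
        have hrare := hs1 v hv (by omega)
        rw [hvq] at hrare
        refine ⟨hq, ?_⟩
        have hk : k ≤ ((Finset.range p).filter (Rare n (Nat.card M) (array n s) U)).card := by
          rcases ih2 with h6 | h6
          · omega
          · exact h6.2
        refine Nat.succ_le_of_lt (lt_of_le_of_lt hk (Finset.card_lt_card ⟨?_, fun hsub => ?_⟩))
        · intro i hi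
          simp only [Finset.mem_filter, Finset.mem_range] at hi ⊢
          exact ⟨by omega, hi.2⟩
        · have := hsub (Finset.mem_filter.2 ⟨Finset.mem_range.2 (Nat.lt_succ_self q), hrare⟩)
          simp only [Finset.mem_filter, Finset.mem_range] at this
          omega
      · left; rfl

/-- The evaluation of the current word. -/
noncomputable def queryExp : Exp :=
  mulExp e (frequentExp e (List.range (Nat.card M))) (scan e (Nat.card M * Nat.card M + 1)).2

theorem count_map_range (U : ℕ → ℕ) (a n : ℕ) :
    ((List.range n).map U).count a = ((Finset.range n).filter fun i => U i = a).card := by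
  induction n with
  | zero => simp
  | succ n ih =>
    rw [List.range_succ, List.map_append, List.count_append, ih, Finset.range_add_one,
      Finset.filter_insert]
    by_cases h : U n = a
    · rw [if_pos h, Finset.card_insert_of_notMem (by simp)]
      simp [h]
    · rw [if_neg h]
      simp [h]

theorem eval_queryExp [Finite M] (hM : IsZG M) {n : ℕ} {s : State} {U : ℕ → ℕ}
    (h2 : s.reg 2 = n + 1) (h : Bags n (Nat.card M) (array n s) U Set.univ) (hU : U n = e 1) :
    (queryExp e).eval s = e (((List.range n).map U).map (decode e)).prod := by
  classical
  obtain ⟨h3, h4⟩ := eval_scan e h2 h hU (Nat.card M * Nat.card M + 1)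
  have hcard := card_rare_le h
  -- The number of rounds exceeds the number of rare positions, so the scan has passed the end of
  -- the word.
  have hp : (scan e (Nat.card M * Nat.card M + 1)).1.eval s = n + 1 := by
    rcases h4 with h4 | ⟨h4, h5⟩
    · exact h4
    · exfalso
      have : ((Finset.range ((scan e (Nat.card M * Nat.card M + 1)).1.eval s)).filter
          (Rare n (Nat.card M) (array n s) U)).card
          ≤ ((Finset.range n).filter (Rare n (Nat.card M) (array n s) U)).card :=
        Finset.card_le_card (Finset.filter_subset_filter _
          (Finset.range_subset_range.2 h4))
      omega
  rw [hp, rareProd_eq e (Nat.le_succ n) (fun i hi _ hr => by have := hr.1; omega)] at h3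
  have hcount : ∀ a < Nat.card M, array n s (2 + a) n = ((List.range n).map U).count a := by
    intro a ha
    rw [h.count_eq ha, count_map_range]
    simp
  rw [queryExp, eval_mulExp e (eval_frequentExp e h2 _) h3,
    prod_eq_prod_frequent_mul hM ((List.range n).map U) (List.range (Nat.card M)) (decode e)
      List.nodup_range]
  congr 3
  · congr 1
    refine List.map_congr_left fun a ha => ?_
    rw [frequentTerm, hcount a (List.mem_range.1 ha)]
  · rw [rareProd, List.map_map]
    congr 1
    refine List.map_congr_left fun i hi => ?_
    have hi := List.mem_range.1 hi
    have hlt := h.letter_lt i hi.le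
    simp only [rareTerm, Rare, Function.comp, List.mem_range, hcount _ hlt, hi, hlt, true_and]
    by_cases hc : Nat.card M ≤ ((List.range n).map U).count (U i)
    · rw [if_pos hc, if_neg (by omega)]
    · rw [if_neg hc, if_pos (by omega)]

theorem map_decode_codes {n : ℕ} (u : Fin n → M) :
    ((List.range n).map (codes e u)).map (decode e) = List.ofFn u := by
  refine List.ext_getElem (by simp) fun i hi _ => ?_
  simp only [List.length_map, List.length_range] at hi
  simp [codes, hi]

/-! ### The algorithm -/

/-- Initialization of the preprocessing. -/
def initCmds : List Cmd :=
  [.set 2 (.add (.reg 0) (.lit 1)), .set 7 (.reg 0), .store (.reg 0) (.lit (e 1))]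

/-- Selection of the next position by the preprocessing. -/
def nextCmds : List Cmd :=
  [.set 7 (.sub (.reg 7) (.lit 1)), .set 0 (.reg 7), .set 1 (.load (.reg 7))]

/-- The algorithm that keeps for each letter the unordered list of its positions. -/
noncomputable def bagAlgorithm : Algorithm where
  preprocess := loop (Cmd.compile (initCmds e)) 7 (Cmd.compile (nextCmds ++ insertCmds))
  update := Cmd.compile (removeCmds ++ insertCmds)
  query := Cmd.compile [.set 0 (queryExp e)]

/-! ### The invariant under preprocessing, updates and queries -/

variable {e} {B n : ℕ} {s : State} {u : Fin n → M}

/-- The input word already is row `0`, and only the sentinel has to be added. No position below `n`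
is registered yet, so row `1` may contain anything. -/
theorem represents_init (hB : n + 1 ≤ B) (hcard : Nat.card M ≤ B) (w : Fin n → M) :
    Represents e B (Cmd.execs (initCmds e) (inputState e w)) w {i | n ≤ i} n := by
  have he1 := (e 1).2
  have hs : Cmd.execs (initCmds e) (inputState e w) = (((inputState e w).setReg 2 (n + 1)).setReg
      7 n).setMem n (e 1) := by
    simp [Cmd.execs, initCmds, Cmd.exec, State.setReg, State.setMem, inputState]
  have hbd : (inputState e w).Bounded B := by
    refine ⟨fun r => ?_, fun p => ?_⟩
    · simp only [inputState]; split_ifs <;> omega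
    · simp only [inputState]
      split_ifs with h
      · have := (e (w ⟨p, h⟩)).2; omega
      · omega
  have hlet : ∀ p, (Cmd.execs (initCmds e) (inputState e w)).mem p
      = if p ≤ n then codes e w p else 0 := by
    intro p
    rw [hs]
    simp only [State.setReg, State.setMem, inputState, Function.update_apply, codes]
    rcases lt_trichotomy p n with h | h | h
    · simp [h, h.ne, h.le]
    · simp [h]
    · simp [h.not_ge, h.ne', h.not_gt]
  refine ⟨?_, ?_, fun r hr hr7 => ?_, ?_, ?_⟩
  · simp [hs, State.setReg, State.setMem]
  · simp [hs, State.setReg, State.setMem]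
  · rw [hs]
    simp [State.setReg, State.setMem, inputState, hr7, show r ≠ 2 by omega, show r ≠ 0 by omega]
  · rw [hs]
    exact ((hbd.setReg hB).setReg (by omega)).setMem (by omega)
  · refine ⟨fun i hi => ?_, fun i hi => ?_, fun a ha j hj => ?_, fun i hi hiS => ?_⟩
    · simp [array, hlet, hi]
    · unfold codes
      split_ifs
      · exact (e _).2
      · exact he1
    -- The counters lie at addresses beyond `n`, where the memory is still `0`; all lists are empty.
    · exfalso
      rw [array, hlet, if_neg (by nlinarith)] at hj
      omega
    · have : n ≤ i := hiS
      omega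

theorem Represents.next_insert (hB : n ≤ B) {k : ℕ} (hk : k < n)
    (h : Represents e B s u {i | k + 1 ≤ i} (k + 1)) :
    Represents e B (Cmd.execs (nextCmds ++ insertCmds) s) u {i | k ≤ i} k := by
  have hs : Cmd.execs (nextCmds ++ insertCmds) s
      = Cmd.execs insertCmds (((s.setReg 7 k).setReg 0 k).setReg 1 (e (u ⟨k, hk⟩))) := by
    have hL := h.bags.letter k hk.le
    simp only [array, zero_mul, zero_add, codes, hk, dif_pos] at hL
    simp [Cmd.execs, nextCmds, Cmd.exec, State.setReg, h.reg_seven, hL]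
  have h7 : Represents e B (s.setReg 7 k) u {i | k + 1 ≤ i} k := by
    refine ⟨?_, ?_, fun q hq hq7 => ?_, h.bounded.setReg (by omega), h.bags⟩
    · simpa [State.setReg] using h.reg_two
    · simp [State.setReg]
    · simpa [State.setReg, hq7] using h.reg_eq_zero q hq hq7
  have hlt : (e (u ⟨k, hk⟩) : ℕ) ≤ B := by
    have hL := h.bags.letter k hk.le
    simp only [array, zero_mul, zero_add, codes, hk, dif_pos] at hL
    rw [← hL]
    exact h.bounded.2 k
  have h01 := (h7.setReg (r := 0) (v := k) (by omega) (by omega)).setReg (r := 1) (by omega) hlt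
  have := h01.insert hB (i := ⟨k, hk⟩) (a := u ⟨k, hk⟩) (by simp [State.setReg])
    (by simp [State.setReg]) (by simp)
  rw [hs]
  -- Registering position `k` with the letter that it already has leaves the word unchanged.
  rw [Function.update_eq_self] at this
  convert this using 1
  ext i
  simp only [Set.mem_ofPred_eq, Set.mem_insert_iff]
  omega

theorem Represents.update (hB : n ≤ B) (hcard : Nat.card M ≤ B)
    (h : Represents e B s u Set.univ 0) (i : Fin n) (a : M) :
    Represents e B (updateState e s i a) u Set.univ 0 ∧
    Represents e B (Cmd.execs (removeCmds ++ insertCmds) (updateState e s i a))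
      (Function.update u i a) Set.univ 0 := by
  have h1 : Represents e B (updateState e s i a) u Set.univ 0 :=
    (h.setReg (by omega) (by omega)).setReg (by omega) (by have := (e a).2; omega)
  refine ⟨h1, ?_⟩
  have h2 := h1.remove (i := i) (by simp [updateState, State.setReg]) trivial
  -- Removal takes the old letter from row `0`, so the position and the new letter are still in the
  -- input registers when the insertion starts.
  have hreg : ∀ r < 2, (Cmd.execs removeCmds (updateState e s i a)).reg r
      = (updateState e s i a).reg r := by
    intro r hr
    rw [execs_removeCmds h1.reg_two rfl rfl rfl rfl]
    simp [State.setReg, State.setMem, show r ≠ 3 by omega, show r ≠ 4 by omega,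
      show r ≠ 5 by omega, show r ≠ 6 by omega]
  have h3 := h2.insert hB (i := i) (a := a)
    (by rw [hreg 0 (by omega)]; simp [updateState, State.setReg])
    (by rw [hreg 1 (by omega)]; simp [updateState, State.setReg]) (by simp)
  have hS : Insert.insert (i : ℕ) (Set.univ \ {(i : ℕ)}) = Set.univ := by simp
  rw [hS] at h3
  rw [Cmd.execs, List.foldl_append]
  exact h3

theorem Represents.query [Finite M] (hM : IsZG M) (hcard : Nat.card M ≤ B)
    (h : Represents e B s u Set.univ 0) :
    Represents e B (Cmd.execs [.set 0 (queryExp e)] s) u Set.univ 0 ∧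
    (Cmd.execs [.set 0 (queryExp e)] s).reg 0 = (e (List.ofFn u).prod : ℕ) := by
  have hq := eval_queryExp e hM h.reg_two h.bags (by simp [codes])
  rw [map_decode_codes] at hq
  have hs : Cmd.execs [.set 0 (queryExp e)] s = s.setReg 0 (e (List.ofFn u).prod : ℕ) := by
    simp [Cmd.execs, Cmd.exec, hq]
  rw [hs]
  exact ⟨h.setReg (by omega) (by have := (e (List.ofFn u).prod).2; omega),
    by simp [State.setReg]⟩

theorem Represents.runs_compile {S : Set ℕ} {k : ℕ} (h : Represents e B s u S k)
    (cs : List Cmd) : runs (Cmd.compile cs) s = Cmd.execs cs s :=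
  Cmd.runs_compile cs fun r hr => h.reg_eq_zero r (by omega) (by omega)

/-- The algorithm is correct, and runs in linear and constant time. -/
theorem solves_bagAlgorithm [Finite M] (hM : IsZG M) {c L : ℕ} (hc : 2 ≤ c)
    (hcard : Nat.card M ≤ c)
    (hinit : ∀ i ∈ Cmd.compile (initCmds e), i.ConstLE c)
    (hbody : ∀ i ∈ Cmd.compile (nextCmds ++ insertCmds), i.ConstLE c)
    (hupd : ∀ i ∈ (bagAlgorithm e).update, i.ConstLE c)
    (hqry : ∀ i ∈ (bagAlgorithm e).query, i.ConstLE c)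
    (hLinit : (Cmd.compile (initCmds e)).length ≤ L)
    (hLbody : (Cmd.compile (nextCmds ++ insertCmds)).length ≤ L)
    (hLupd : (bagAlgorithm e).update.length ≤ L) (hLqry : (bagAlgorithm e).query.length ≤ L) :
    Solves (bagAlgorithm e) e (fun n => (n + c) ^ 2 ^ L)
      (fun n => L + (n * (L + 2) + 1)) (fun _ => L) := by
  have hV : ∀ (n : ℕ) {l : ℕ}, l ≤ L → (n + c) ^ 2 ^ l ≤ (n + c) ^ 2 ^ L := fun n l hl =>
    Nat.pow_le_pow_right (by omega) (Nat.pow_le_pow_right (by omega) hl)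
  have hpre : ∀ (n : ℕ) (w : Fin n → M), ∃ t ≤ L + (n * (L + 2) + 1), ∃ s,
      Represents e (n + c) s w Set.univ 0 ∧
      Run (bagAlgorithm e).preprocess ((n + c) ^ 2 ^ L) (inputState e w) t s := by
    intro n w
    have hzero : ∀ r, 8 ≤ r → (inputState e w).reg r = 0 := fun r hr => by
      simp [inputState, show r ≠ 0 by omega]
    have hbd : (inputState e w).Bounded (n + c) := by
      refine ⟨fun r => ?_, fun p => ?_⟩
      · simp only [inputState]; split_ifs <;> omega
      · simp only [inputState]
        split_ifs with h
        · have := (e (w ⟨p, h⟩)).2; omega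
        · omega
    obtain ⟨s, hs, hrun⟩ := run_loop (Cmd.isStraight_compile (initCmds e))
      (Cmd.isStraight_compile (nextCmds ++ insertCmds)) (r := 7) (B := n + c) (by omega)
      (fun i hi => (hinit i hi).mono (by omega)) (fun i hi => (hbody i hi).mono (by omega))
      (hV n hLinit) (hV n hLbody)
      -- The conjunct `k ≤ n` ensures that the position registered in the next round lies in the
      -- word.
      (fun k s => k ≤ n ∧ Represents e (n + c) s w {i | k ≤ i} k)
      (fun k s h => h.2.bounded) (fun k s h => h.2.reg_seven)
      (fun k s h => ⟨by omega, by
        rw [h.2.runs_compile]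
        exact h.2.next_insert (by omega) (by omega)⟩)
      hbd (n := n)
      ⟨le_rfl, by
        rw [Cmd.runs_compile _ hzero]
        exact represents_init (by omega) (by omega) w⟩
    refine ⟨_, ?_, s, ?_, hrun⟩
    · gcongr
    · simpa using hs.2
  have hupdate : ∀ (n : ℕ) (s : State) (u : Fin n → M) (i : Fin n) (a : M),
      Represents e (n + c) s u Set.univ 0 →
      Represents e (n + c) (runs (bagAlgorithm e).update (updateState e s i a))
        (Function.update u i a) Set.univ 0 ∧
      Run (bagAlgorithm e).update ((n + c) ^ 2 ^ L) (updateState e s i a)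
        (bagAlgorithm e).update.length (runs (bagAlgorithm e).update (updateState e s i a)) := by
    intro n s u i a h
    obtain ⟨h1, h2⟩ := h.update (by omega) (by omega) i a
    refine ⟨?_, run_straight (Cmd.isStraight_compile _) (B := n + c) (by omega)
      (fun i hi => (hupd i hi).mono (by omega)) h1.bounded (hV n hLupd)⟩
    rw [bagAlgorithm, h1.runs_compile]
    exact h2
  have hquery : ∀ (n : ℕ) (s : State) (u : Fin n → M),
      Represents e (n + c) s u Set.univ 0 →
      Represents e (n + c) (runs (bagAlgorithm e).query s) u Set.univ 0 ∧
      (runs (bagAlgorithm e).query s).reg 0 = (e (List.ofFn u).prod : ℕ) ∧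
      Run (bagAlgorithm e).query ((n + c) ^ 2 ^ L) s
        (bagAlgorithm e).query.length (runs (bagAlgorithm e).query s) := by
    intro n s u h
    obtain ⟨h1, h2⟩ := h.query hM (by omega)
    refine ⟨?_, ?_, run_straight (Cmd.isStraight_compile _) (B := n + c) (by omega)
      (fun i hi => (hqry i hi).mono (by omega)) h.bounded (hV n hLqry)⟩
    · rw [bagAlgorithm, h.runs_compile]
      exact h1
    · rw [bagAlgorithm, h.runs_compile]
      exact h2
  -- By determinism every reachable state is one produced by the explicit runs, so it satisfies the
  -- invariant with the same bound `n + c`, however many operations were performed.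
  have hreach : ∀ (n : ℕ) (w : Fin n → M) (s : State) (u : Fin n → M),
      Reachable (bagAlgorithm e) e ((n + c) ^ 2 ^ L) w s u →
      Represents e (n + c) s u Set.univ 0 := by
    intro n w s u h
    induction h with
    | preprocess h =>
      obtain ⟨t, -, s', hs', hrun⟩ := hpre n w
      rw [h.state_eq hrun]
      exact hs'
    | update i a _ h ih =>
      obtain ⟨h1, h2⟩ := hupdate n _ _ i a ih
      rw [h.state_eq h2]
      exact h1
    | query _ h ih =>
      obtain ⟨h1, -, h2⟩ := hquery n _ _ ih
      rw [h.state_eq h2]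
      exact h1
  refine ⟨fun n w => ?_, fun n w s u h i a => ?_, fun n w s u h => ?_⟩
  · obtain ⟨t, ht, s, -, hrun⟩ := hpre n w
    exact ⟨t, ht, s, hrun⟩
  · exact ⟨_, hLupd, _, (hupdate n s u i a (hreach n w s u h)).2⟩
  · obtain ⟨-, h1, h2⟩ := hquery n s u (hreach n w s u h)
    exact ⟨_, hLqry, _, h2, h1⟩

end

end DynamicWord

theorem mainTheorem3 (M : Type*) [Monoid M] [Finite M] (hM : IsZG M) :
    DynamicWord.InO M (fun _ => 1) := by
  intro e
  obtain ⟨c₁, h₁⟩ := RAM.exists_constLE (RAM.Cmd.compile (DynamicWord.initCmds e))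
  obtain ⟨c₂, h₂⟩ := RAM.exists_constLE
    (RAM.Cmd.compile (DynamicWord.nextCmds ++ DynamicWord.insertCmds))
  obtain ⟨c₃, h₃⟩ := RAM.exists_constLE (DynamicWord.bagAlgorithm e).update
  obtain ⟨c₄, h₄⟩ := RAM.exists_constLE (DynamicWord.bagAlgorithm e).query
  obtain ⟨c, hc⟩ : ∃ c, c = c₁ + c₂ + c₃ + c₄ + Nat.card M + 2 := ⟨_, rfl⟩
  obtain ⟨L, hL⟩ : ∃ L, L = (RAM.Cmd.compile (DynamicWord.initCmds e)).length
    + (RAM.Cmd.compile (DynamicWord.nextCmds ++ DynamicWord.insertCmds)).length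
    + (DynamicWord.bagAlgorithm e).update.length
    + (DynamicWord.bagAlgorithm e).query.length := ⟨_, rfl⟩
  refine ⟨DynamicWord.bagAlgorithm e, (Polynomial.X + Polynomial.C c) ^ 2 ^ L,
    fun n => L + (n * (L + 2) + 1), fun _ => L, ?_, ?_, ?_⟩
  -- For `n ≥ 1`, the constant part `L + 1` is at most `(L + 1) * n`, which is added to `(L + 2) *
  -- n`.
  · refine Asymptotics.IsBigO.of_bound (2 * L + 3) ?_
    filter_upwards [Filter.eventually_ge_atTop 1] with n hn
    rw [Real.norm_natCast, Real.norm_natCast]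
    exact_mod_cast (by nlinarith : L + (n * (L + 2) + 1) ≤ (2 * L + 3) * n)
  · exact Asymptotics.isBigO_const_const _ one_ne_zero _
  · simp only [Polynomial.eval_pow, Polynomial.eval_add, Polynomial.eval_X, Polynomial.eval_C]
    exact DynamicWord.solves_bagAlgorithm hM (by omega) (by omega)
      (fun i hi => (h₁ i hi).mono (by omega)) (fun i hi => (h₂ i hi).mono (by omega))
      (fun i hi => (h₃ i hi).mono (by omega)) (fun i hi => (h₄ i hi).mono (by omega))
      (by omega) (by omega) (by omega) (by omega)
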